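/- \textbf{Setting.} Let $\Theta\subset\mathbb R^d$ be compact, let $\mathbf f$ be a forward model, $\mathbf d$ data, $\ell$ a likelihood and $p$ a prior, and write $h(\theta)=\ell(\theta\mid\mathbf d,\mathbf f)\,p(\theta)$ (a measurable function), $g=\log h$, and $\pi(d\theta)=h(\theta)\,d\theta/\int_\Theta h$ on $\Theta$. Assume that $h$ is $C^\infty$ on $\Theta$ (it is the restriction of a $C^\infty$ function on $\mathbb R^d$) and bounded below on $\Theta$ by a positive constant. Proposals from $\theta$ have the form $r(\theta,z)$ with random input $z\sim\nu$ (e.g. standard Gaussian), $r$ measurable; for $\theta\in\Theta$ the law of $r(\theta,z)$ has a density $q(\theta,\cdot)$ on $\Theta$ with $q$ jointly measurable, $q(\theta,\cdot)$ $C^\infty$ on $\Theta$ in the same sense, and $q\ge c>0$ on $\Theta\times\Theta$. Fix $\beta>0$, $\lambda\in(0,\infty)$ and an arbitrary real sequence $(\gamma_t)_{t\ge0}$. \textbf{Local approximation.} Let $N=(d+1)(d+2)/2$. For a finite set $\mathcal S\subset\Theta$ of points at which the model has been run, let $\mathcal B_\theta(\mathcal S)$ be the set of points of $\mathcal S$ in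 the smallest closed ball $\bar B(\theta,R)$ containing at least $N$ of them (all of $\mathcal S$ if it has fewer than $N$ points). A finite set $Y$ is poised if every interpolation problem on $Y$ has exactly one solution among polynomials of degree at most $2$. For a finite set $Y$ let $A_Y(\theta)$ be the value at $\theta$ of the quadratic interpolant of $g$ on $Y$ if $Y$ is poised; otherwise $A_Y(\theta)=g(\theta)$ if $\theta\in Y$, and $A_Y(\theta)$ is given by an arbitrary fixed measurable rule if $\theta\notin Y$. Put $a_{\mathcal S}(\theta)=A_{\mathcal B_\theta(\mathcal S)}(\theta)$ and, for $j\in\mathcal B_\theta(\mathcal S)$, $a^{\sim j}_{\mathcal S}(\theta)=A_{\mathcal B_\theta(\mathcal S)\setminus\{j\}}(\theta)$. We say that $\theta$ passes the poisedness test in $\mathcal S$ if $\mathcal B_\theta(\mathcal S)$ is poised and its Lagrange polynomials are bounded by $\lambda$ in absolute value on $\bar B(\theta,R)$. \textbf{One step of a chain} from state $\theta^-$, with sample set $\mathcal S$ and parameter $\gamma_t$. Draw $z\sim\nu$ and put $\theta^+=r(\theta^-,z)$. Repeat the following pass. Put $$\zeta=\frac{e^{a_{\mathcal S}(\theta^+)}q(\theta^+,\theta^-)}{e^{a_{\mathcal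 S}(\theta^-)}q(\theta^-,\theta^+)},$$ let $\zeta^{\pm,\sim j}$ be the same expression with $a_{\mathcal S}(\theta^\pm)$ replaced by $a^{\sim j}_{\mathcal S}(\theta^\pm)$, and let $$\epsilon^\pm=\max_j\Big(|\min(1,\zeta)-\min(1,\zeta^{\pm,\sim j})|+|\min(1,1/\zeta)-\min(1,1/\zeta^{\pm,\sim j})|\Big),$$ the maximum being over $j\in\mathcal B_{\theta^\pm}(\mathcal S)$ and equal to $0$ if this set is empty. Draw $u$ uniformly on $[0,1]$. If $u<\beta$, add to $\mathcal S$ one of $\theta^+,\theta^-$, chosen with probability $1/2$ each; otherwise, if ($\epsilon^+\ge\epsilon^-$ and $\epsilon^+\ge\gamma_t$) or $\theta^+$ fails the poisedness test, add $\theta^+$ to $\mathcal S$; otherwise, if ($\epsilon^->\epsilon^+$ and $\epsilon^-\ge\gamma_t$) or $\theta^-$ fails the poisedness test, add $\theta^-$ to $\mathcal S$. The passes end when no such refinement is called for, or when both $\theta^+$ and $\theta^-$ already belong to $\mathcal S$ (so that $\mathcal S$ can no longer change). Then, with $u'$ uniform on $[0,1]$, the new state is $\theta^+$ if $u'<\min(1,\zeta)$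 for the final $\mathcal S$, and $\theta^-$ otherwise. \textbf{Parallel run.} There are $n$ chains with initial states in $\Theta$, and a shared finite initial sample set in $\Theta$. At time $k$ the chains in a prescribed set $\sigma(k)\subset\{1,\dots,n\}$ each make one step with independent randomness, starting from the current shared sample set, and all points they add are then shared; every chain is in $\sigma(k)$ for infinitely many $k$ (for example $\sigma(k)=\{1,\dots,n\}$ for all $k$, or the chains take turns). Let $X^{(i)}_t$ be the state of chain $i$ after its first $t$ steps; its step from $X^{(i)}_t$ uses $\gamma_t$. \textbf{Theorem.} For every $1\le i\le n$, $$\lim_{t\to\infty}\big\|\mathcal L(X^{(i)}_t)-\pi\big\|_{TV}=0,$$ where $\|\mu-\nu\|_{TV}=\sup_A|\mu(A)-\nu(A)|$ over Borel sets $A$. -/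

import Mathlib

open MeasureTheory ProbabilityTheory Filter Topology
open scoped ContDiff NNReal

namespace LocalApproxMCMC

/-- The ambient parameter space `ℝ^d` with its Euclidean norm. -/
abbrev E (d : ℕ) := EuclideanSpace ℝ (Fin d)

/-! ### Total variation, smoothness on a compact set -/

/-- Total variation distance of two probability measures: `sup_A |μ A - ν A|`. -/
noncomputable def tvDist {α : Type*} [MeasurableSpace α] (μ ν : Measure α) : ℝ :=
  ⨆ A : {A : Set α // MeasurableSet A}, |μ.real (A : Set α) - ν.real (A : Set α)|

/-- `f` is `C^∞` on the (compact, not necessarily regular) set `Θ`: on `Θ` it coincides with a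
`C^∞` function on the whole space. -/
def SmoothOn {d : ℕ} (f : E d → ℝ) (Θ : Set (E d)) : Prop :=
  ∃ F : E d → ℝ, ContDiff ℝ ∞ F ∧ Set.EqOn F f Θ

/-! ### The Bayesian inference problem -/

/-- Prior density, likelihood, forward model and data. The likelihood `lik θ data model` may use
the forward model in any way. -/
structure BayesProblem (d m : ℕ) where
  prior : E d → ℝ
  lik : E d → E m → (E d → E m) → ℝ
  model : E d → E m
  data : E m

/-- The unnormalised posterior density `ℓ(θ | d, f) p(θ)`. -/
def BayesProblem.unnorm {d m : ℕ} (B : BayesProblem d m) (θ : E d) : ℝ :=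
  B.lik θ B.data B.model * B.prior θ

/-- The function that is approximated: the log-posterior, up to the additive normalising
constant (which quadratic interpolation reproduces and which cancels in every ratio). -/
noncomputable def BayesProblem.logPost {d m : ℕ} (B : BayesProblem d m) (θ : E d) : ℝ :=
  Real.log (B.unnorm θ)

/-- The posterior distribution `π` on the state space `Θ`. -/
noncomputable def BayesProblem.posterior {d m : ℕ} (B : BayesProblem d m) (Θ : Set (E d)) :
    Measure (E d) :=
  (volume.restrict Θ).withDensity
    fun θ => ENNReal.ofReal (B.unnorm θ / ∫ x in Θ, B.unnorm x)

/-! ### Quadratic interpolation and poisedness -/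

/-- Polynomials in `d` variables of total degree at most two. -/
noncomputable abbrev Quad (d : ℕ) := MvPolynomial.restrictTotalDegree (Fin d) ℝ 2

/-- Value of a quadratic polynomial at a point. -/
noncomputable def quadVal {d : ℕ} (p : Quad d) (x : E d) : ℝ :=
  MvPolynomial.eval (fun i => x i) (p : MvPolynomial (Fin d) ℝ)

/-- The finite set `Y` is poised for quadratic interpolation: every interpolation problem on `Y`
has exactly one solution. (In particular `Y` has exactly `(d+1)(d+2)/2` elements.) -/
def Poised {d : ℕ} (Y : Finset (E d)) : Prop :=
  ∀ v : E d → ℝ, ∃! p : Quad d, ∀ y ∈ Y, quadVal p y = v y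

open scoped Classical in
/-- The quadratic interpolating `v` on a poised set `Y` (and `0` if `Y` is not poised). -/
noncomputable def interp {d : ℕ} (Y : Finset (E d)) (v : E d → ℝ) : Quad d :=
  if h : Poised Y then (h v).exists.choose else 0

open scoped Classical in
/-- The Lagrange polynomial of `y` for the set `Y`. -/
noncomputable def lagrangePoly {d : ℕ} (Y : Finset (E d)) (y : E d) : Quad d :=
  interp Y fun x => if x = y then 1 else 0

/-- `Y` is `lam`-poised in the set `D`: `Y` is poised and its Lagrange polynomials are bounded by
`lam` in absolute value on `D`. -/
def LamPoised {d : ℕ} (lam : ℝ) (Y : Finset (E d)) (D : Set (E d)) : Prop :=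
  Poised Y ∧ ∀ y ∈ Y, ∀ x ∈ D, |quadVal (lagrangePoly Y y) x| ≤ lam

/-! ### Local approximation -/

/-- The number of coefficients of a quadratic in `d` variables. -/
def numCoeff (d : ℕ) : ℕ := (d + 1) * (d + 2) / 2

open scoped Classical in
/-- The points of `S` in the smallest closed ball about `θ` that holds at least `N` points of `S`
(`N = (d+1)(d+2)/2`): those with fewer than `N` points of `S` strictly closer to `θ`.
It has exactly `N` points unless there is a tie for the `N`-th nearest point (or `S` has fewer
than `N` points); it is then not poised. -/
noncomputable def nearest {d : ℕ} (θ : E d) (S : Finset (E d)) : Finset (E d) :=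
  S.filter fun s => (S.filter fun y => dist y θ < dist s θ).card < numCoeff d

/-- The radius `R` of that ball. -/
noncomputable def radius {d : ℕ} (θ : E d) (S : Finset (E d)) : ℝ≥0 :=
  (nearest θ S).sup fun s => nndist s θ

/-- The test on the interpolation points that is used for the approximation at `θ`. -/
def PoisedAt {d : ℕ} (lam : ℝ) (θ : E d) (S : Finset (E d)) : Prop :=
  LamPoised lam (nearest θ S) (Metric.closedBall θ (radius θ S))

/-- The parameters of the algorithm.
* `r θ z` : the proposal made from `θ` with the random input `z`; `q` : its density;
* `β` : probability of a random refinement; `γ` : thresholds for the cross validation test;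
* `lam` : the constant of the poisedness test;
* `alt θ Y` : value at `θ` of the fit that replaces quadratic interpolation when the points of `Y`
  do not determine a quadratic (for instance after one of `N` points has been left out). -/
structure AlgParams (d : ℕ) (Z : Type*) where
  r : E d → Z → E d
  q : E d → E d → ℝ
  β : ℝ
  γ : ℕ → ℝ
  lam : ℝ
  alt : E d → Finset (E d) → ℝ

section Step

variable {d m : ℕ} {Z : Type*} (B : BayesProblem d m) (A : AlgParams d Z)

open scoped Classical in
/-- The approximation of the log-posterior at `θ` that is built from its values on `Y`: quadratic
interpolation. If this is not uniquely solvable, the known value is used when `θ` itself is a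
sample point, and the rule `alt` otherwise. -/
noncomputable def fit (θ : E d) (Y : Finset (E d)) : ℝ :=
  if Poised Y then quadVal (interp Y B.logPost) θ
  else if θ ∈ Y then B.logPost θ else A.alt θ Y

/-- `LocApprox(θ, S, ∅)`. -/
noncomputable def locApprox (θ : E d) (S : Finset (E d)) : ℝ :=
  fit B A θ (nearest θ S)

open scoped Classical in
/-- `LocApprox(θ, S, j)`: the neighbour `j` is left out. -/
noncomputable def locApproxLOO (θ : E d) (S : Finset (E d)) (j : E d) : ℝ :=
  fit B A θ ((nearest θ S).erase j)

/-- The Metropolis–Hastings ratio when the log-posterior has the values `ap` at the proposed point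
`θp` and `am` at the current point `θm`. -/
noncomputable def mhRatio (θm θp : E d) (ap am : ℝ) : ℝ :=
  (Real.exp ap * A.q θp θm) / (Real.exp am * A.q θm θp)

/-- Nominal ratio `ζ`. -/
noncomputable def zeta (θm θp : E d) (S : Finset (E d)) : ℝ :=
  mhRatio A θm θp (locApprox B A θp S) (locApprox B A θm S)

/-- Leave-one-out ratio `ζ^{+,∼j}`. -/
noncomputable def zetaPlus (θm θp : E d) (S : Finset (E d)) (j : E d) : ℝ :=
  mhRatio A θm θp (locApproxLOO B A θp S j) (locApprox B A θm S)

/-- Leave-one-out ratio `ζ^{-,∼j}`. -/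
noncomputable def zetaMinus (θm θp : E d) (S : Finset (E d)) (j : E d) : ℝ :=
  mhRatio A θm θp (locApprox B A θp S) (locApproxLOO B A θm S j)

/-- Difference of the acceptance probabilities, forward and reverse, that belong to two ratios. -/
noncomputable def cvGap (x y : ℝ) : ℝ :=
  |min 1 x - min 1 y| + |min 1 (1 / x) - min 1 (1 / y)|

/-- Cross validation error indicator `ε⁺`: maximum over the neighbours of `θp`. -/
noncomputable def epsPlus (θm θp : E d) (S : Finset (E d)) : ℝ :=
  ⨆ j : {j : E d // j ∈ nearest θp S}, cvGap (zeta B A θm θp S) (zetaPlus B A θm θp S j)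

/-- Cross validation error indicator `ε⁻`: maximum over the neighbours of `θm`. -/
noncomputable def epsMinus (θm θp : E d) (S : Finset (E d)) : ℝ :=
  ⨆ j : {j : E d // j ∈ nearest θm S}, cvGap (zeta B A θm θp S) (zetaMinus B A θm θp S j)

/-- Acceptance probability. -/
noncomputable def accProb (θm θp : E d) (S : Finset (E d)) : ℝ :=
  min 1 (zeta B A θm θp S)

open scoped Classical in
/-- The point, if any, at which one pass of the refinement loop refines. `g` is the current
threshold `γ_t`; `w.1` is the uniform variable that decides on random refinement, and `w.2` is a
uniform variable that chooses between the two points with equal probabilities. -/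
noncomputable def refinePoint (g : ℝ) (θm θp : E d) (S : Finset (E d)) (w : ℝ × ℝ) :
    Option (E d) :=
  if w.1 < A.β then some (if w.2 < 1 / 2 then θp else θm)
  else if (epsMinus B A θm θp S ≤ epsPlus B A θm θp S ∧ g ≤ epsPlus B A θm θp S)
      ∨ ¬ PoisedAt A.lam θp S then some θp
  else if (epsPlus B A θm θp S < epsMinus B A θm θp S ∧ g ≤ epsMinus B A θm θp S)
      ∨ ¬ PoisedAt A.lam θm S then some θm
  else none

open scoped Classical in
/-- `RefineNear(θ, S)`: the model is run exactly at `θ`. (As the approximated function is fixed, a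
set of evaluations is represented by the set of evaluation points.) -/
noncomputable def refineNear (θ : E d) (S : Finset (E d)) : Finset (E d) := insert θ S

/-- The sample set at the beginning of pass `p` of the refinement loop, were the loop never
left. -/
noncomputable def passSet (g : ℝ) (θm θp : E d) (S : Finset (E d)) (w : ℕ → ℝ × ℝ) :
    ℕ → Finset (E d)
  | 0 => S
  | p + 1 =>
    match refinePoint B A g θm θp (passSet g θm θp S w p) (w p) with
    | none => passSet g θm θp S w p
    | some x => refineNear x (passSet g θm θp S w p)

/-- The refinement loop is left at pass `p`: the pass does not refine, or no further refinement
is possible because both points already belong to the sample set (which then can no longer change,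
so that repeating the pass has no effect). -/
def leaves (g : ℝ) (θm θp : E d) (S : Finset (E d)) (w : ℕ → ℝ × ℝ) (p : ℕ) : Prop :=
  refinePoint B A g θm θp (passSet B A g θm θp S w p) (w p) = none ∨
    (θp ∈ passSet B A g θm θp S w p ∧ θm ∈ passSet B A g θm θp S w p)

/-- The sample set when the refinement loop is left (almost surely it is left). -/
noncomputable def finalSet (g : ℝ) (θm θp : E d) (S : Finset (E d)) (w : ℕ → ℝ × ℝ) :
    Finset (E d) :=
  passSet B A g θm θp S w (sInf {p | leaves B A g θm θp S w p})

/-- The randomness used by one step of a chain: the input of the proposal, the pairs of uniform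
variables of the passes of the refinement loop, and the uniform variable that decides on
acceptance. -/
abbrev Noise (Z : Type*) := Z × (ℕ → ℝ × ℝ) × ℝ

/-- The kernel `K_t` driven by the noise `ξ`: new state and new sample set, when started from the
state `θm` and the sample set `S`. -/
noncomputable def chainStep (g : ℝ) (θm : E d) (S : Finset (E d)) (ξ : Noise Z) :
    E d × Finset (E d) :=
  let θp := A.r θm ξ.1
  let S' := finalSet B A g θm θp S ξ.2.1
  (if ξ.2.2 < accProb B A θm θp S' then θp else θm, S')

end Step

/-- The uniform distribution on `[0,1]`. -/
noncomputable def unif : Measure ℝ := volume.restrict (Set.Icc 0 1)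

instance : IsProbabilityMeasure unif := ⟨by simp [unif]⟩

/-- The law of the randomness used by one step, when `ν` is the law of the proposal input. -/
noncomputable def noiseLaw {Z : Type*} [MeasurableSpace Z] (ν : Measure Z) : Measure (Noise Z) :=
  ν.prod ((Measure.infinitePi fun _ : ℕ => unif.prod unif).prod unif)

/-! ### Parallel chains -/

/-- The states of `n` chains together with the sample set they share. -/
structure ParState (d n : ℕ) where
  X : Fin n → E d
  S : Finset (E d)

open scoped Classical in
/-- `n` chains run in parallel with a shared sample set. At time `k` the chains in `σ k` each
make one step, starting from the current shared sample set; all their new evaluations are then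
shared. Thus `σ k = univ` describes synchronous chains, and singletons `σ k` describe chains that
take turns, in any order and at any relative speed. The argument `η (k, i)` is the noise of
chain `i` at time `k`. -/
noncomputable def parallelRun {d m n : ℕ} {Z : Type*} (B : BayesProblem d m) (A : AlgParams d Z)
    (σ : ℕ → Finset (Fin n)) (x₀ : Fin n → E d) (S₀ : Finset (E d)) (η : ℕ × Fin n → Noise Z) :
    ℕ → ParState d n
  | 0 => ⟨x₀, S₀⟩
  | k + 1 =>
    let s := parallelRun B A σ x₀ S₀ η k
    let out := fun i =>
      chainStep B A (A.γ (Nat.count (fun j => i ∈ σ j) k)) (s.X i) s.S (η (k, i))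
    { X := fun i => if i ∈ σ k then (out i).1 else s.X i
      S := s.S ∪ (σ k).biUnion fun i => (out i).2 }

/-- `X_t^{(i)}`: the state of chain `i` after it has made `t` steps. -/
noncomputable def chainState {d m n : ℕ} {Z : Type*} (B : BayesProblem d m) (A : AlgParams d Z)
    (σ : ℕ → Finset (Fin n)) (x₀ : Fin n → E d) (S₀ : Finset (E d)) (η : ℕ × Fin n → Noise Z)
    (i : Fin n) (t : ℕ) : E d :=
  (parallelRun B A σ x₀ S₀ η (Nat.nth (fun k => i ∈ σ k) t)).X i

/-! ### Sufficient conditions for convergence -/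

open scoped Classical in
/-- The assumptions on state space, target, proposal and parameters. (The other conditions,
quadratic interpolation on the nearest points, refinement exactly at the chosen point and the
poisedness tests, are built into the algorithm above; `γ` is unrestricted.) -/
structure SufficientConditions {d m : ℕ} {Z : Type*} [MeasurableSpace Z] (Θ : Set (E d))
    (B : BayesProblem d m) (A : AlgParams d Z) (ν : Measure Z) : Prop where
  compact : IsCompact Θ
  /-- The target has a smooth density that is bounded away from zero. -/
  target_measurable : Measurable B.unnorm
  target_smooth : SmoothOn B.unnorm Θ
  target_lower : ∃ c > 0, ∀ θ ∈ Θ, c ≤ B.unnorm θ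
  /-- The proposal `r θ z`, with `z` distributed according to `ν`, has the density `q θ` on `Θ`. -/
  proposal_measurable : Measurable fun x : E d × Z => A.r x.1 x.2
  density_measurable : Measurable fun x : E d × E d => A.q x.1 x.2
  proposal_law : ∀ θ ∈ Θ, ν.map (A.r θ) =
    (volume.restrict Θ).withDensity fun y => ENNReal.ofReal (A.q θ y)
  /-- The proposal densities are smooth and uniformly bounded away from zero. -/
  proposal_smooth : ∀ θ ∈ Θ, SmoothOn (A.q θ) Θ
  proposal_lower : ∃ c > 0, ∀ θ ∈ Θ, ∀ y ∈ Θ, c ≤ A.q θ y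
  β_pos : 0 < A.β
  lam_pos : 0 < A.lam
  /-- The auxiliary fit depends measurably on its data. -/
  alt_measurable : ∀ k : ℕ,
    Measurable fun x : E d × (Fin k → E d) => A.alt x.1 (Finset.univ.image x.2)

end LocalApproxMCMC

/-! Each step is compared with a step of the exact Metropolis–Hastings chain from the same state,
driven by the same noise. A chain with adaptive samples is not Markov by itself, but the exact step
does not read the sample set, so its law is the law of the current state pushed through a fixed
kernel. This kernel preserves the posterior by detailed balance and satisfies a Doeblin minorization
on `Θ`, so it contracts the total variation distance to the posterior by some `κ < 1`
(`exists_contraction`). The distances therefore satisfy `a (k + 1) ≤ κ * a k + e k` whenever the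
chain moves, where `e k` is the probability that the two steps differ, and they are unchanged at
other times. It remains to show `e k → 0` (`tendsto_measure_ne`).

The steps can differ only if the acceptance variable falls between the approximate and the exact
acceptance probability, so it is enough that their difference tends to zero in probability. When the
refinement loop ends, either both points are samples, and the approximation is exact there, or both
neighbour sets pass the poisedness test. In the second case the Lagrange polynomials sum to one and
are bounded by `lam`, so the error is at most a constant times the variation of the log-posterior
between the point and its neighbours (`abs_locApprox_sub_le`). This zeroth-order bound suffices: by
uniform continuity it is small once `N` samples lie close to the point.

Samples do accumulate: whenever the chain moves, its proposal hits a given set of positive volume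
and is refined at random in the first pass, with probability bounded below. Finitely many such sets
control all points of the support of Lebesgue measure on `Θ` (`exists_surrounding_family`), and
proposals almost surely land in that support. A chain still sitting outside the support is taken
care of by random refinement at its current point (`tendsto_measure_notMem`).

Measurability is reduced to tuples of points by enumerating the random finite sets
(`FinsetMeasurable.measurable_apply`). -/

namespace LocalApproxMCMC

/-! ### Measurable random finite sets -/

section FinsetMeasurable

variable {Ω Ω' α β ι : Type*} [MeasurableSpace Ω] [MeasurableSpace Ω'] [MeasurableSpace α]
  [MeasurableSpace β]

/-- A random finite set is measurable if its elements can be enumerated by a sequence of measurable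
partially defined random points. -/
def FinsetMeasurable (F : Ω → Finset α) : Prop :=
  ∃ (y : ℕ → Ω → α) (b : ℕ → Set Ω), (∀ n, Measurable (y n)) ∧ (∀ n, MeasurableSet (b n)) ∧
    ∀ o x, x ∈ F o ↔ ∃ n, o ∈ b n ∧ y n o = x

theorem FinsetMeasurable.of_countable [Countable ι] [Nonempty α] {F : Ω → Finset α} (y : ι → Ω → α)
    (b : ι → Set Ω) (hy : ∀ n, Measurable (y n)) (hb : ∀ n, MeasurableSet (b n))
    (hF : ∀ o x, x ∈ F o ↔ ∃ n, o ∈ b n ∧ y n o = x) : FinsetMeasurable F := by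
  rcases isEmpty_or_nonempty ι with hι | hι
  · exact ⟨fun _ _ => Classical.arbitrary α, fun _ => ∅, by simp, by simp,
      fun o x => by simp [hF]⟩
  · obtain ⟨f, hf⟩ := exists_surjective_nat ι
    exact ⟨fun n => y (f n), fun n => b (f n), fun n => hy _, fun n => hb _,
      fun o x => by rw [hF, hf.exists]⟩

theorem FinsetMeasurable.comp {F : Ω → Finset α} (hF : FinsetMeasurable F) {f : Ω' → Ω}
    (hf : Measurable f) : FinsetMeasurable fun o => F (f o) := by
  obtain ⟨y, b, hy, hb, h⟩ := hF
  exact ⟨fun n o => y n (f o), fun n => f ⁻¹' b n, fun n => (hy n).comp hf, fun n => hf (hb n),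
    fun o x => h (f o) x⟩

theorem FinsetMeasurable.const [Nonempty α] (s : Finset α) : FinsetMeasurable fun _ : Ω => s :=
  .of_countable (ι := s) (fun a _ => a) (fun _ => Set.univ) (fun _ => measurable_const)
    (fun _ => .univ) (by simp)

theorem FinsetMeasurable.singleton [Nonempty α] {f : Ω → α} (hf : Measurable f) :
    FinsetMeasurable fun o => {f o} :=
  .of_countable (ι := Unit) (fun _ => f) (fun _ => Set.univ) (fun _ => hf)
    (fun _ => .univ) (by simp [eq_comm])

/-- Pairs of indices are countable, so pieces switched on by measurable events can be enumerated
together. Unions, case distinctions and the sample set at a random exit pass are instances. -/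
theorem FinsetMeasurable.iUnion [Countable ι] [Nonempty α] {F : Ω → Finset α} {G : ι → Ω → Finset α}
    {c : ι → Set Ω} (hG : ∀ j, FinsetMeasurable (G j)) (hc : ∀ j, MeasurableSet (c j))
    (hF : ∀ o x, x ∈ F o ↔ ∃ j, o ∈ c j ∧ x ∈ G j o) : FinsetMeasurable F := by
  choose y b hy hb h using hG
  refine .of_countable (ι := ι × ℕ) (fun p => y p.1 p.2) (fun p => c p.1 ∩ b p.1 p.2)
    (fun p => hy _ _) (fun p => (hc _).inter (hb _ _)) fun o x => ?_
  simp only [hF, h, Prod.exists, Set.mem_inter_iff]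
  constructor
  · rintro ⟨j, hj, n, hn, rfl⟩
    exact ⟨j, n, ⟨hj, hn⟩, rfl⟩
  · rintro ⟨j, n, ⟨hj, hn⟩, rfl⟩
    exact ⟨j, hj, n, hn, rfl⟩

theorem FinsetMeasurable.union [DecidableEq α] [Nonempty α] {F G : Ω → Finset α} (hF : FinsetMeasurable F)
    (hG : FinsetMeasurable G) : FinsetMeasurable fun o => F o ∪ G o :=
  .iUnion (ι := Bool) (G := fun b => bif b then F else G) (c := fun _ => Set.univ)
    (by rintro (_ | _) <;> assumption) (fun _ => .univ) (by simp [or_comm])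

theorem FinsetMeasurable.biUnion [DecidableEq α] [Nonempty α] (s : Finset ι) {F : ι → Ω → Finset α}
    (hF : ∀ i ∈ s, FinsetMeasurable (F i)) : FinsetMeasurable fun o => s.biUnion fun i => F i o :=
  .iUnion (ι := s) (G := fun i => F i) (c := fun _ => Set.univ)
    (fun i => hF i i.2) (fun _ => .univ) (by simp)

theorem FinsetMeasurable.ite [Nonempty α] {p : Ω → Prop} {_ : DecidablePred p} {F G : Ω → Finset α}
    (hp : MeasurableSet {o | p o})
    (hF : FinsetMeasurable F) (hG : FinsetMeasurable G) :
    FinsetMeasurable fun o => if p o then F o else G o := by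
  refine .iUnion (ι := Bool) (G := fun b => bif b then F else G)
    (c := fun b => bif b then {o | p o} else {o | p o}ᶜ)
    (by rintro (_ | _) <;> assumption) ?_ ?_
  · rintro (_ | _)
    exacts [hp.compl, hp]
  · intro o x
    by_cases h : p o <;> simp [h]

theorem FinsetMeasurable.filter {F : Ω → Finset α} (hF : FinsetMeasurable F) {p : Ω → α → Prop}
    {_ : ∀ o, DecidablePred (p o)} (hp : MeasurableSet {x : Ω × α | p x.1 x.2}) :
    FinsetMeasurable fun o => (F o).filter (p o) := by
  obtain ⟨y, b, hy, hb, h⟩ := hF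
  refine ⟨y, fun n => b n ∩ {o | p o (y n o)}, hy,
    fun n => (hb n).inter ((measurable_id.prodMk (hy n)) hp), fun o x => ?_⟩
  simp only [Finset.mem_filter, h, Set.mem_inter_iff, Set.mem_ofPred_eq]
  constructor
  · rintro ⟨⟨n, hn, rfl⟩, hx⟩
    exact ⟨n, ⟨hn, hx⟩, rfl⟩
  · rintro ⟨n, ⟨hn, hx⟩, rfl⟩
    exact ⟨⟨n, hn, rfl⟩, hx⟩

theorem FinsetMeasurable.measurableSet_exists {F : Ω → Finset α} (hF : FinsetMeasurable F)
    {p : Ω → α → Prop} (hp : MeasurableSet {x : Ω × α | p x.1 x.2}) :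
    MeasurableSet {o | ∃ x ∈ F o, p o x} := by
  obtain ⟨y, b, hy, hb, h⟩ := hF
  have : {o | ∃ x ∈ F o, p o x} = ⋃ n, b n ∩ {o | p o (y n o)} := by
    ext o
    simp only [h, Set.mem_ofPred_eq, Set.mem_iUnion, Set.mem_inter_iff]
    constructor
    · rintro ⟨_, ⟨n, hn, rfl⟩, hx⟩
      exact ⟨n, hn, hx⟩
    · rintro ⟨n, hn, hx⟩
      exact ⟨_, ⟨n, hn, rfl⟩, hx⟩
  rw [this]
  exact .iUnion fun n => (hb n).inter ((measurable_id.prodMk (hy n)) hp)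

variable [MeasurableEq α]

theorem FinsetMeasurable.measurableSet_mem {F : Ω → Finset α} (hF : FinsetMeasurable F)
    {f : Ω → α} (hf : Measurable f) : MeasurableSet {o | f o ∈ F o} := by
  have := hF.measurableSet_exists (p := fun o x => x = f o)
    (measurableSet_eq_fun measurable_snd (hf.comp measurable_fst))
  simpa using this

/-- A function of a measurable random finite set is measurable if it is measurable as a function of
tuples of distinct points that enumerate the set. -/
theorem FinsetMeasurable.measurable_apply [DecidableEq α] {F : Ω → Finset α} (hF : FinsetMeasurable F)
    {G : Ω → Finset α → β}
    (hG : ∀ k : ℕ, ∃ H : Ω × (Fin k → α) → β, Measurable H ∧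
      ∀ o x, Function.Injective x → H (o, x) = G o (Finset.univ.image x)) :
    Measurable fun o => G o (F o) := by
  obtain ⟨y, b, hy, hb, h⟩ := hF
  choose H hH hHG using hG
  intro T hT
  -- On `D s` the indices in `s` list the elements of `F` without repetition. There are countably
  -- many patterns `s` and they cover `Ω`, so it suffices to treat `G` on each `D s`, where it is a
  -- function of a measurable tuple.
  let D : (Σ k : ℕ, Fin k → ℕ) → Set Ω := fun s =>
    {o | (∀ i, o ∈ b (s.2 i)) ∧ (∀ i j, i ≠ j → y (s.2 i) o ≠ y (s.2 j) o) ∧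
      ∀ m, o ∈ b m → ∃ i, y m o = y (s.2 i) o}
  have hD : ∀ s, MeasurableSet (D s) := fun s => by
    refine .inter ?_ (.inter ?_ ?_)
    · exact .congr (.iInter fun i => hb (s.2 i)) (by ext; simp; rfl)
    · refine .congr (.iInter fun i => .iInter fun j => .iInter fun _ : i ≠ j =>
        (measurableSet_eq_fun (hy (s.2 i)) (hy (s.2 j))).compl) (by ext; simp; rfl)
    · refine .congr (.iInter fun m => (hb m).compl.union (.iUnion fun i =>
        (measurableSet_eq_fun (hy m) (hy (s.2 i))))) ?_
      ext; simp [imp_iff_not_or]; rfl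
  have himg : ∀ s, ∀ o ∈ D s, F o = Finset.univ.image fun i => y (s.2 i) o := by
    rintro s o ⟨h1, h2, h3⟩
    ext x
    rw [h]
    simp only [Finset.mem_image, Finset.mem_univ, true_and]
    constructor
    · rintro ⟨m, hm, rfl⟩
      obtain ⟨i, hi⟩ := h3 m hm
      exact ⟨i, hi.symm⟩
    · rintro ⟨i, rfl⟩
      exact ⟨_, h1 i, rfl⟩
  have hval : ∀ s, ∀ o ∈ D s, H s.1 (o, fun i => y (s.2 i) o) = G o (F o) := by
    intro s o ho
    rw [himg s o ho]
    refine hHG _ _ _ fun i j hij => ?_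
    by_contra hne
    exact ho.2.1 i j hne hij
  have hcov : ∀ o, ∃ s, o ∈ D s := by
    intro o
    have hex : ∀ x : F o, ∃ n, o ∈ b n ∧ y n o = x := fun x => (h o x).1 x.2
    choose n hn hyn using hex
    let e := (F o).equivFin.symm
    refine ⟨⟨(F o).card, fun i => n (e i)⟩, fun i => hn _, fun i j hij => ?_, fun m hm => ?_⟩
    · simp only [hyn]
      exact fun hh => hij (e.injective (Subtype.ext hh))
    · refine ⟨e.symm ⟨y m o, (h o _).2 ⟨m, hm, rfl⟩⟩, ?_⟩
      simp [hyn]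
  have : (fun o => G o (F o)) ⁻¹' T =
      ⋃ s, D s ∩ (fun o => H s.1 (o, fun i => y (s.2 i) o)) ⁻¹' T := by
    ext o
    simp only [Set.mem_preimage, Set.mem_iUnion, Set.mem_inter_iff]
    constructor
    · intro ho
      obtain ⟨s, hs⟩ := hcov o
      exact ⟨s, hs, by rwa [hval s o hs]⟩
    · rintro ⟨s, hs, ho⟩
      rwa [hval s o hs] at ho
  rw [this]
  exact .iUnion fun s => (hD s).inter
    ((hH s.1).comp (measurable_id.prodMk (measurable_pi_lambda _ fun i => hy _)) hT)

theorem FinsetMeasurable.measurable_card {F : Ω → Finset α} (hF : FinsetMeasurable F) :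
    Measurable fun o => (F o).card := by
  classical
  exact hF.measurable_apply (G := fun _ s => s.card) fun k => ⟨fun _ => k, measurable_const,
    fun _ x hx => by simp [Finset.card_image_of_injective _ hx]⟩

/-- Real-valued suprema over measurable random finite sets are measurable. -/
theorem FinsetMeasurable.measurable_iSup {F : Ω → Finset α} (hF : FinsetMeasurable F)
    {f : Ω → α → ℝ} (hf : Measurable fun x : Ω × α => f x.1 x.2) :
    Measurable fun o => ⨆ j : {j // j ∈ F o}, f o j := by
  classical
  refine hF.measurable_apply (G := fun o s => ⨆ j : {j // j ∈ s}, f o j) fun k =>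
    ⟨fun p => ⨆ i, f p.1 (p.2 i), ?_, fun o x _ => ?_⟩
  · exact Measurable.iSup fun i => hf.comp
      (measurable_fst.prodMk ((measurable_pi_apply i).comp measurable_snd))
  · have hs : Function.Surjective (fun i : Fin k =>
        (⟨x i, by simp⟩ : {j // j ∈ Finset.univ.image x})) := by
      rintro ⟨j, hj⟩
      obtain ⟨i, -, rfl⟩ := Finset.mem_image.1 hj
      exact ⟨i, rfl⟩
    exact hs.iSup_comp (g := fun j : {j // j ∈ Finset.univ.image x} => f o j)

end FinsetMeasurable

/-! ### Quadratic interpolation in coordinates -/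

section Interpolation

variable {d : ℕ}

theorem quadVal_smul (c : ℝ) (p : Quad d) (x : E d) : quadVal (c • p) x = c * quadVal p x := by
  simp [quadVal]

theorem quadVal_sum {ι : Type*} (s : Finset ι) (p : ι → Quad d) (x : E d) :
    quadVal (∑ i ∈ s, p i) x = ∑ i ∈ s, quadVal (p i) x := by
  simp [quadVal]

theorem continuous_quadVal (p : Quad d) : Continuous (quadVal p) := by
  unfold quadVal
  exact (MvPolynomial.continuous_eval _).comp (by fun_prop)

theorem exists_quadVal_eq_one : ∃ p : Quad d, ∀ x, quadVal p x = 1 :=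
  ⟨⟨1, by simp [MvPolynomial.mem_restrictTotalDegree]⟩, fun x => by simp [quadVal]⟩

theorem quadVal_interp {Y : Finset (E d)} (h : Poised Y) (v : E d → ℝ) {y : E d} (hy : y ∈ Y) :
    quadVal (interp Y v) y = v y := by
  rw [interp, dif_pos h]
  exact (h v).exists.choose_spec y hy

theorem interp_unique {Y : Finset (E d)} (h : Poised Y) {v : E d → ℝ} {p : Quad d}
    (hp : ∀ y ∈ Y, quadVal p y = v y) : interp Y v = p :=
  (h v).unique (fun _ hy => quadVal_interp h v hy) hp

/-- The right-hand side takes the values `v` on `Y`, and a poised set determines its interpolant. -/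
theorem interp_eq_sum_lagrangePoly {Y : Finset (E d)} (h : Poised Y) (v : E d → ℝ) :
    interp Y v = ∑ y ∈ Y, v y • lagrangePoly Y y := by
  refine interp_unique h fun x hx => ?_
  rw [quadVal_sum, Finset.sum_eq_single x]
  · rw [quadVal_smul, lagrangePoly, quadVal_interp h _ hx]; simp
  · intro y hy hyx
    rw [quadVal_smul, lagrangePoly, quadVal_interp h _ hx]; simp [hyx.symm]
  · exact fun hx' => absurd hx hx'

/-- The constant `1` is a quadratic, hence its own interpolant. This turns the approximation error
into a weighted sum of differences of the log-posterior. -/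
theorem sum_lagrangePoly {Y : Finset (E d)} (h : Poised Y) (x : E d) :
    ∑ y ∈ Y, quadVal (lagrangePoly Y y) x = 1 := by
  obtain ⟨p, hp⟩ := exists_quadVal_eq_one (d := d)
  have h1 := interp_eq_sum_lagrangePoly h fun _ => 1
  rw [interp_unique h (p := p) fun y _ => hp y] at h1
  rw [← hp x, h1, quadVal_sum]
  simp

noncomputable instance : Module.Finite ℝ (Quad d) := by
  unfold Quad
  infer_instance

/-- The dimension of the space of quadratics in `d` variables. -/
noncomputable def quadDim (d : ℕ) : ℕ := Module.finrank ℝ (Quad d)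

/-- A basis of the space of quadratics. -/
noncomputable def quadBasis (d : ℕ) : Module.Basis (Fin (quadDim d)) ℝ (Quad d) :=
  Module.finBasis ℝ (Quad d)

/-- The Vandermonde matrix of the tuple `x`. -/
noncomputable def vandermonde {k : ℕ} (x : Fin k → E d) : Matrix (Fin k) (Fin (quadDim d)) ℝ :=
  fun i j => quadVal (quadBasis d j) (x i)

theorem quadVal_eq_sum (p : Quad d) (x : E d) :
    quadVal p x = ∑ j, (quadBasis d).repr p j * quadVal (quadBasis d j) x := by
  conv_lhs => rw [← (quadBasis d).sum_repr p, quadVal_sum]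
  simp [quadVal_smul]

theorem vandermonde_mulVec_repr {k : ℕ} (x : Fin k → E d) (p : Quad d) :
    (vandermonde x).mulVec ((quadBasis d).repr p) = fun i => quadVal p (x i) := by
  ext i
  rw [quadVal_eq_sum]
  simp [Matrix.mulVec, dotProduct, vandermonde, mul_comm]

/-- In a basis of the quadratics, interpolation on distinct nodes is the linear system of the
Vandermonde matrix. -/
theorem poised_image_iff_bijective {k : ℕ} {x : Fin k → E d} (hx : Function.Injective x) :
    Poised (Finset.univ.image x) ↔ Function.Bijective (vandermonde x).mulVec := by
  have key : ∀ v : E d → ℝ, (∃! p : Quad d, ∀ y ∈ Finset.univ.image x, quadVal p y = v y) ↔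
      ∃! c, (vandermonde x).mulVec c = v ∘ x := by
    intro v
    refine Iff.trans ?_ ((quadBasis d).equivFun.toEquiv.bijective).existsUnique_iff.symm
    refine existsUnique_congr fun p => ?_
    have := vandermonde_mulVec_repr x p
    simp only [LinearEquiv.coe_toEquiv, Module.Basis.equivFun_apply, this]
    simp [funext_iff]
  classical
  rw [Function.bijective_iff_existsUnique]
  constructor
  · intro h w
    -- A vector indexed by the nodes is extended to a function of points; this is consistent because
    -- the nodes are distinct, and the value `0` off the nodes is arbitrary.
    have := (key (fun y => if hy : ∃ i, x i = y then w hy.choose else 0)).1 (h _)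
    convert this using 3
    ext i
    have hex : ∃ j, x j = x i := ⟨i, rfl⟩
    simp only [Function.comp, hex, dif_pos]
    rw [hx hex.choose_spec]
  · exact fun h v => (key v).2 (h _)

/-- A bijective Vandermonde map is a linear isomorphism, so nodes and basis quadratics are equal in
number. Tuples of any other length are thus trivial in the measurability proofs. -/
theorem eq_quadDim_of_poised_image {k : ℕ} {x : Fin k → E d} (hx : Function.Injective x)
    (h : Poised (Finset.univ.image x)) : k = quadDim d := by
  have := (poised_image_iff_bijective hx).1 h
  have e := LinearEquiv.ofBijective (vandermonde x).mulVecLin this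
  simpa using e.finrank_eq.symm

theorem card_eq_quadDim_of_poised {Y : Finset (E d)} (h : Poised Y) : Y.card = quadDim d := by
  refine eq_quadDim_of_poised_image (x := fun i => (Y.equivFin.symm i : E d))
    (Subtype.val_injective.comp Y.equivFin.symm.injective) ?_
  convert h
  ext y
  simp only [Finset.mem_image, Finset.mem_univ, true_and]
  exact ⟨by rintro ⟨i, rfl⟩; exact (Y.equivFin.symm i).2, fun hy => ⟨Y.equivFin ⟨y, hy⟩, by simp⟩⟩

theorem poised_image_iff_det {x : Fin (quadDim d) → E d} (hx : Function.Injective x) :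
    Poised (Finset.univ.image x) ↔ (vandermonde x).det ≠ 0 := by
  rw [poised_image_iff_bijective hx, ← isUnit_iff_ne_zero, ← Matrix.isUnit_iff_isUnit_det,
    ← Matrix.mulVec_injective_iff_isUnit, Function.Bijective, and_iff_left_iff_imp]
  rw [Matrix.mulVec_injective_iff_isUnit, ← Matrix.mulVec_surjective_iff_isUnit]
  exact id

theorem quadVal_interp_image {x : Fin (quadDim d) → E d} (hx : Function.Injective x)
    (h : Poised (Finset.univ.image x)) (v : E d → ℝ) (z : E d) :
    quadVal (interp (Finset.univ.image x) v) z =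
      ∑ j, ((vandermonde x)⁻¹.mulVec (v ∘ x)) j * quadVal (quadBasis d j) z := by
  have hdet : IsUnit (vandermonde x).det := isUnit_iff_ne_zero.2 ((poised_image_iff_det hx).1 h)
  have h1 := vandermonde_mulVec_repr x (interp (Finset.univ.image x) v)
  have h2 : (fun i => quadVal (interp (Finset.univ.image x) v) (x i)) = v ∘ x := by
    ext i
    exact quadVal_interp h v (by simp)
  rw [quadVal_eq_sum, ← h2, ← h1, Matrix.mulVec_mulVec, Matrix.nonsing_inv_mul _ hdet,
    Matrix.one_mulVec]

theorem continuous_vandermonde {k : ℕ} : Continuous (vandermonde (d := d) (k := k)) :=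
  continuous_pi fun i => continuous_pi fun _ => (continuous_quadVal _).comp (continuous_apply i)

theorem measurable_det_vandermonde :
    Measurable fun x : Fin (quadDim d) → E d => (vandermonde x).det :=
  continuous_vandermonde.matrix_det.measurable

/-- The inverse is the adjugate divided by the determinant; with `0⁻¹ = 0` this formula is
measurable on singular matrices too. -/
theorem measurable_inv_vandermonde (i j : Fin (quadDim d)) :
    Measurable fun x : Fin (quadDim d) → E d => (vandermonde x)⁻¹ i j := by
  simp only [Matrix.inv_def, Matrix.smul_apply, Ring.inverse_eq_inv', smul_eq_mul]
  exact measurable_det_vandermonde.inv.mul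
    (continuous_vandermonde.matrix_adjugate.matrix_elem i j).measurable

theorem quadVal_lagrangePoly_image {x : Fin (quadDim d) → E d} (hx : Function.Injective x)
    (h : Poised (Finset.univ.image x)) (i : Fin (quadDim d)) (z : E d) :
    quadVal (lagrangePoly (Finset.univ.image x) (x i)) z =
      ∑ j, (vandermonde x)⁻¹ j i * quadVal (quadBasis d j) z := by
  have : (fun y => if y = x i then (1 : ℝ) else 0) ∘ x = Pi.single i 1 := by
    ext j
    simp [Pi.single_apply, hx.eq_iff]
  rw [lagrangePoly, quadVal_interp_image hx h]
  have hcol : (vandermonde x)⁻¹.mulVec ((fun y => if y = x i then (1 : ℝ) else 0) ∘ x) =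
      fun j => (vandermonde x)⁻¹ j i := by
    rw [this, Matrix.mulVec_single_one]
    rfl
  exact Finset.sum_congr rfl fun j _ => by rw [congrFun hcol j]

end Interpolation

/-! ### Measurability of the algorithm -/

section Measurability

variable {Ω : Type*} [MeasurableSpace Ω] {d m : ℕ} {Z : Type*} [MeasurableSpace Z]

/-- For tuples of length `quadDim d` poisedness is nonvanishing of a continuous determinant; for
other lengths it is false. -/
theorem FinsetMeasurable.measurable_poised {Y : Ω → Finset (E d)} (hY : FinsetMeasurable Y) :
    Measurable fun o => Poised (Y o) := by
  refine hY.measurable_apply (G := fun _ Y => Poised Y) fun k => ?_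
  by_cases hk : k = quadDim d
  · subst hk
    refine ⟨fun p => (vandermonde p.2).det ≠ 0, ?_, fun o x hx => ?_⟩
    · refine measurableSet_setOfPred.1 (measurableSet_eq_fun ?_ measurable_const).compl
      exact measurable_det_vandermonde.comp measurable_snd
    · simp only [poised_image_iff_det hx]
  · exact ⟨fun _ => False, measurable_const, fun o x hx =>
      propext ⟨False.elim, fun h => hk (eq_quadDim_of_poised_image hx h)⟩⟩

theorem FinsetMeasurable.measurable_quadVal_interp {Y : Ω → Finset (E d)}
    (hY : FinsetMeasurable Y) {v : E d → ℝ} (hv : Measurable v) {θ : Ω → E d}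
    (hθ : Measurable θ) : Measurable fun o => quadVal (interp (Y o) v) (θ o) := by
  refine hY.measurable_apply (G := fun o Y => quadVal (interp Y v) (θ o)) fun k => ?_
  have h0 : ∀ {Y : Finset (E d)} (z : E d), ¬ Poised Y → quadVal (interp Y v) z = 0 := by
    intro Y z h
    rw [interp, dif_neg h]
    simp [quadVal]
  by_cases hk : k = quadDim d
  · subst hk
    refine ⟨fun p => if (vandermonde p.2).det ≠ 0 then ∑ j, ((vandermonde p.2)⁻¹.mulVec (v ∘ p.2)) j
      * quadVal (quadBasis d j) (θ p.1) else 0, ?_, fun o x hx => ?_⟩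
    · refine .ite (measurableSet_eq_fun ?_ measurable_const).compl ?_ measurable_const
      · exact measurable_det_vandermonde.comp measurable_snd
      · refine Finset.measurable_sum _ fun j _ => .mul ?_
          ((continuous_quadVal _).measurable.comp (hθ.comp measurable_fst))
        simp only [Matrix.mulVec, dotProduct]
        refine Finset.measurable_sum _ fun i _ => .mul
          ((measurable_inv_vandermonde _ _).comp measurable_snd) ?_
        exact hv.comp ((measurable_pi_apply i).comp measurable_snd)
    · by_cases h : (vandermonde x).det ≠ 0
      · simp only [if_pos h, quadVal_interp_image hx ((poised_image_iff_det hx).2 h)]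
      · simp only [if_neg h]
        rw [h0 _ fun h' => h ((poised_image_iff_det hx).1 h')]
  · exact ⟨fun _ => 0, measurable_const, fun o x hx =>
      (h0 _ fun h => hk (eq_quadDim_of_poised_image hx h)).symm⟩

/-- Rescaling to the unit ball makes the dense sequence independent of center and radius. By
continuity the bound on the ball becomes countably many conditions, which are measurable in `θ` and
`R`. -/
theorem forall_mem_closedBall_abs_le_iff {f : E d → ℝ} (hf : Continuous f) (θ : E d) (R : ℝ≥0)
    (c : ℝ) : (∀ z ∈ Metric.closedBall θ R, |f z| ≤ c) ↔
      ∀ n, |f (θ + (R : ℝ) •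
        (TopologicalSpace.denseSeq (Metric.closedBall (0 : E d) 1) n : E d))| ≤ c := by
  constructor
  · intro h n
    refine h _ ?_
    rw [Metric.mem_closedBall, dist_eq_norm, add_sub_cancel_left, norm_smul]
    have h1 := (TopologicalSpace.denseSeq (Metric.closedBall (0 : E d) 1) n).2
    rw [mem_closedBall_zero_iff] at h1
    simpa using mul_le_mul_of_nonneg_left h1 R.2
  · intro h z hz
    have hcl : IsClosed {u : Metric.closedBall (0 : E d) 1 | |f (θ + (R : ℝ) • (u : E d))| ≤ c} :=
      isClosed_le (by fun_prop) continuous_const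
    have hall : ∀ u : Metric.closedBall (0 : E d) 1, |f (θ + (R : ℝ) • (u : E d))| ≤ c := by
      intro u
      have := (TopologicalSpace.denseRange_denseSeq (Metric.closedBall (0 : E d) 1)) u
      exact closure_minimal (by rintro _ ⟨n, rfl⟩; exact h n) hcl this
    rw [Metric.mem_closedBall, dist_eq_norm] at hz
    -- Rescaling needs `R ≠ 0`; for `R = 0` the ball is the single point `θ`.
    rcases eq_or_ne R 0 with rfl | hR
    · have : z = θ := by simpa [sub_eq_zero] using hz
      subst this
      simpa using hall ⟨0, by simp⟩
    · have hR' : (0 : ℝ) < R := by positivity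
      have := hall ⟨(R : ℝ)⁻¹ • (z - θ), by
        rw [mem_closedBall_zero_iff, norm_smul, norm_inv, Real.norm_of_nonneg hR'.le,
          inv_mul_le_iff₀ hR']
        simpa using hz⟩
      simpa [smul_smul, hR'.ne'] using this

instance : Nonempty (Metric.closedBall (0 : E d) 1) := ⟨⟨0, by simp⟩⟩

theorem FinsetMeasurable.measurable_lamPoised {Y : Ω → Finset (E d)} (hY : FinsetMeasurable Y)
    {θ : Ω → E d} (hθ : Measurable θ) {R : Ω → ℝ≥0} (hR : Measurable R) (lam : ℝ) :
    Measurable fun o => LamPoised lam (Y o) (Metric.closedBall (θ o) (R o)) := by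
  refine hY.measurable_apply
    (G := fun o Y => LamPoised lam Y (Metric.closedBall (θ o) (R o))) fun k => ?_
  by_cases hk : k = quadDim d
  · subst hk
    refine ⟨fun p => (vandermonde p.2).det ≠ 0 ∧ ∀ i n, |∑ j, (vandermonde p.2)⁻¹ j i *
      quadVal (quadBasis d j) (θ p.1 + (R p.1 : ℝ) •
        (TopologicalSpace.denseSeq (Metric.closedBall (0 : E d) 1) n : E d))| ≤ lam, ?_,
      fun o x hx => ?_⟩
    · refine measurableSet_setOfPred.1 (.inter (measurableSet_eq_fun ?_ measurable_const).compl ?_)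
      · exact measurable_det_vandermonde.comp measurable_snd
      · refine measurableSet_setOfPred.2 (.forall fun i => .forall fun n => measurableSet_setOfPred.1 ?_)
        refine measurableSet_le ?_ measurable_const
        refine measurable_norm.comp (Finset.measurable_sum _ fun j _ => .mul
          ((measurable_inv_vandermonde _ _).comp measurable_snd)
          ((continuous_quadVal _).measurable.comp ?_))
        exact (hθ.comp measurable_fst).add
          ((measurable_coe_nnreal_real.comp (hR.comp measurable_fst)).smul_const _)
    · simp only [LamPoised, ← poised_image_iff_det hx, eq_iff_iff]
      refine and_congr_right fun h => ?_
      simp only [Finset.mem_image, Finset.mem_univ, true_and, forall_exists_index,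
        forall_apply_eq_imp_iff]
      refine forall_congr' fun i => ?_
      rw [forall_mem_closedBall_abs_le_iff (continuous_quadVal _)]
      simp only [quadVal_lagrangePoly_image hx h]
  · exact ⟨fun _ => False, measurable_const, fun o x hx =>
      propext ⟨False.elim, fun h => hk (eq_quadDim_of_poised_image hx h.1)⟩⟩

theorem FinsetMeasurable.nearest {S : Ω → Finset (E d)} (hS : FinsetMeasurable S) {θ : Ω → E d}
    (hθ : Measurable θ) : FinsetMeasurable fun o => nearest (θ o) (S o) := by
  classical
  refine hS.filter (p := fun o s => ((S o).filter fun y => dist y (θ o) < dist s (θ o)).card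
    < numCoeff d) ?_
  refine measurableSet_lt (FinsetMeasurable.measurable_card
    (F := fun x : Ω × E d => (S x.1).filter fun y => dist y (θ x.1) < dist x.2 (θ x.1))
    ((hS.comp measurable_fst).filter ?_)) measurable_const
  exact measurableSet_lt (by fun_prop) (by fun_prop)

theorem FinsetMeasurable.measurable_radius {S : Ω → Finset (E d)} (hS : FinsetMeasurable S)
    {θ : Ω → E d} (hθ : Measurable θ) : Measurable fun o => radius (θ o) (S o) := by
  refine (hS.nearest hθ).measurable_apply (G := fun o Y => Y.sup fun s => nndist s (θ o))
    fun k => ⟨fun p => Finset.univ.sup fun i => nndist (p.2 i) (θ p.1), ?_, fun o x _ => ?_⟩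
  · have : (fun p : Ω × (Fin k → E d) => Finset.univ.sup fun i => nndist (p.2 i) (θ p.1)) =
        Finset.univ.sup fun i => fun p => nndist (p.2 i) (θ p.1) := by
      ext p
      rw [Finset.sup_apply]
    rw [this]
    refine Finset.sup_induction measurable_const (fun _ h1 _ h2 => h1.sup h2) fun i _ => ?_
    fun_prop
  · rw [Finset.sup_image]
    rfl

theorem FinsetMeasurable.measurable_poisedAt {S : Ω → Finset (E d)} (hS : FinsetMeasurable S)
    {θ : Ω → E d} (hθ : Measurable θ) (lam : ℝ) :
    Measurable fun o => PoisedAt lam (θ o) (S o) :=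
  (hS.nearest hθ).measurable_lamPoised hθ (hS.measurable_radius hθ) lam

/-- The data that the algorithm uses are measurable. -/
structure MeasurableData (B : BayesProblem d m) (A : AlgParams d Z) : Prop where
  unnorm : Measurable B.unnorm
  proposal : Measurable fun x : E d × Z => A.r x.1 x.2
  density : Measurable fun x : E d × E d => A.q x.1 x.2
  alt (k : ℕ) : Measurable fun x : E d × (Fin k → E d) =>
    A.alt x.1 (Finset.univ.image x.2)

variable {B : BayesProblem d m} {A : AlgParams d Z}

theorem MeasurableData.logPost (h : MeasurableData B A) : Measurable B.logPost :=
  Real.measurable_log.comp h.unnorm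

theorem MeasurableData.fit (h : MeasurableData B A) {θ : Ω → E d} (hθ : Measurable θ)
    {Y : Ω → Finset (E d)} (hY : FinsetMeasurable Y) : Measurable fun o => fit B A (θ o) (Y o) := by
  refine .ite (measurableSet_setOfPred.2 hY.measurable_poised)
    (hY.measurable_quadVal_interp h.logPost hθ) (.ite (hY.measurableSet_mem hθ)
      (h.logPost.comp hθ) ?_)
  refine hY.measurable_apply (G := fun o Y => A.alt (θ o) Y) fun k => ⟨fun p =>
    A.alt (θ p.1) (Finset.univ.image p.2), ?_, fun o x _ => rfl⟩
  exact (h.alt k).comp ((hθ.comp measurable_fst).prodMk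
    (measurable_snd (α := Ω) (β := Fin k → E d)))

theorem MeasurableData.locApprox (h : MeasurableData B A) {θ : Ω → E d} (hθ : Measurable θ)
    {S : Ω → Finset (E d)} (hS : FinsetMeasurable S) :
    Measurable fun o => locApprox B A (θ o) (S o) :=
  h.fit hθ (hS.nearest hθ)

theorem MeasurableData.locApproxLOO (h : MeasurableData B A) {θ : Ω → E d} (hθ : Measurable θ)
    {S : Ω → Finset (E d)} (hS : FinsetMeasurable S) {j : Ω → E d} (hj : Measurable j) :
    Measurable fun o => locApproxLOO B A (θ o) (S o) (j o) := by
  refine h.fit hθ ?_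
  simp only [← Finset.filter_ne']
  exact (hS.nearest hθ).filter (p := fun o y => y ≠ j o)
    (measurableSet_eq_fun measurable_snd (hj.comp measurable_fst)).compl

theorem MeasurableData.mhRatio (h : MeasurableData B A) {θm θp : Ω → E d} (hm : Measurable θm)
    (hp : Measurable θp) {ap am : Ω → ℝ} (hap : Measurable ap) (ham : Measurable am) :
    Measurable fun o => mhRatio A (θm o) (θp o) (ap o) (am o) :=
  ((Real.measurable_exp.comp hap).mul (h.density.comp (hp.prodMk hm))).div
    ((Real.measurable_exp.comp ham).mul (h.density.comp (hm.prodMk hp)))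

theorem MeasurableData.zeta (h : MeasurableData B A) {θm θp : Ω → E d} (hm : Measurable θm)
    (hp : Measurable θp) {S : Ω → Finset (E d)} (hS : FinsetMeasurable S) :
    Measurable fun o => zeta B A (θm o) (θp o) (S o) :=
  h.mhRatio hm hp (h.locApprox hp hS) (h.locApprox hm hS)

theorem MeasurableData.accProb (h : MeasurableData B A) {θm θp : Ω → E d} (hm : Measurable θm)
    (hp : Measurable θp) {S : Ω → Finset (E d)} (hS : FinsetMeasurable S) :
    Measurable fun o => accProb B A (θm o) (θp o) (S o) :=
  measurable_const.min (h.zeta hm hp hS)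

theorem measurable_cvGap {f g : Ω → ℝ} (hf : Measurable f) (hg : Measurable g) :
    Measurable fun o => cvGap (f o) (g o) := by
  unfold cvGap
  fun_prop

theorem MeasurableData.epsPlus (h : MeasurableData B A) {θm θp : Ω → E d} (hm : Measurable θm)
    (hp : Measurable θp) {S : Ω → Finset (E d)} (hS : FinsetMeasurable S) :
    Measurable fun o => epsPlus B A (θm o) (θp o) (S o) := by
  have hm1 : Measurable fun x : Ω × E d => θm x.1 := hm.comp measurable_fst
  have hp1 : Measurable fun x : Ω × E d => θp x.1 := hp.comp measurable_fst
  have hS1 := hS.comp (measurable_fst (α := Ω) (β := E d))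
  exact (hS.nearest hp).measurable_iSup (f := fun o j =>
    cvGap (LocalApproxMCMC.zeta B A (θm o) (θp o) (S o)) (zetaPlus B A (θm o) (θp o) (S o) j))
    (measurable_cvGap (h.zeta hm1 hp1 hS1) (h.mhRatio hm1 hp1
      (h.locApproxLOO hp1 hS1 measurable_snd) (h.locApprox hm1 hS1)))

theorem MeasurableData.epsMinus (h : MeasurableData B A) {θm θp : Ω → E d} (hm : Measurable θm)
    (hp : Measurable θp) {S : Ω → Finset (E d)} (hS : FinsetMeasurable S) :
    Measurable fun o => epsMinus B A (θm o) (θp o) (S o) := by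
  have hm1 : Measurable fun x : Ω × E d => θm x.1 := hm.comp measurable_fst
  have hp1 : Measurable fun x : Ω × E d => θp x.1 := hp.comp measurable_fst
  have hS1 := hS.comp (measurable_fst (α := Ω) (β := E d))
  exact (hS.nearest hm).measurable_iSup (f := fun o j =>
    cvGap (LocalApproxMCMC.zeta B A (θm o) (θp o) (S o)) (zetaMinus B A (θm o) (θp o) (S o) j))
    (measurable_cvGap (h.zeta hm1 hp1 hS1) (h.mhRatio hm1 hp1
      (h.locApprox hp1 hS1) (h.locApproxLOO hm1 hS1 measurable_snd)))

theorem MeasurableData.refinePoint_toFinset (h : MeasurableData B A) (g : ℝ) {θm θp : Ω → E d}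
    (hm : Measurable θm) (hp : Measurable θp) {S : Ω → Finset (E d)} (hS : FinsetMeasurable S)
    {w : Ω → ℝ × ℝ} (hw : Measurable w) :
    FinsetMeasurable fun o => (refinePoint B A g (θm o) (θp o) (S o) (w o)).toFinset := by
  have hε := h.epsPlus hm hp hS
  have hε' := h.epsMinus hm hp hS
  simp only [refinePoint, apply_ite Option.toFinset, Option.toFinset_some, Option.toFinset_none]
  refine .ite (measurableSet_lt hw.fst measurable_const) (.singleton
    (.ite (measurableSet_lt hw.snd measurable_const) hp hm)) (.ite ?_ (.singleton hp)
    (.ite ?_ (.singleton hm) (.const _)))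
  · exact ((measurableSet_le hε' hε).inter (measurableSet_le measurable_const hε)).union
      (measurableSet_setOfPred.2 (hS.measurable_poisedAt hp _)).compl
  · exact ((measurableSet_lt hε hε').inter (measurableSet_le measurable_const hε')).union
      (measurableSet_setOfPred.2 (hS.measurable_poisedAt hm _)).compl

open scoped Classical in
omit [MeasurableSpace Z] in
theorem passSet_succ (g : ℝ) (θm θp : E d) (S : Finset (E d)) (w : ℕ → ℝ × ℝ) (p : ℕ) :
    passSet B A g θm θp S w (p + 1) = passSet B A g θm θp S w p ∪
      (refinePoint B A g θm θp (passSet B A g θm θp S w p) (w p)).toFinset := by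
  rw [passSet]
  cases refinePoint B A g θm θp (passSet B A g θm θp S w p) (w p) with
  | none => simp
  | some x => simp only [refineNear, Option.toFinset_some, Finset.union_singleton]

theorem MeasurableData.passSet (h : MeasurableData B A) (g : ℝ) {θm θp : Ω → E d}
    (hm : Measurable θm) (hp : Measurable θp) {S : Ω → Finset (E d)} (hS : FinsetMeasurable S)
    {w : Ω → ℕ → ℝ × ℝ} (hw : Measurable w) (p : ℕ) :
    FinsetMeasurable fun o => passSet B A g (θm o) (θp o) (S o) (w o) p := by
  classical
  induction p with
  | zero => exact hS
  | succ p ih =>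
    simp only [passSet_succ]
    exact ih.union (h.refinePoint_toFinset g hm hp ih ((measurable_pi_apply p).comp hw))

theorem MeasurableData.measurableSet_leaves (h : MeasurableData B A) (g : ℝ) {θm θp : Ω → E d}
    (hm : Measurable θm) (hp : Measurable θp) {S : Ω → Finset (E d)} (hS : FinsetMeasurable S)
    {w : Ω → ℕ → ℝ × ℝ} (hw : Measurable w) (p : ℕ) :
    MeasurableSet {o | leaves B A g (θm o) (θp o) (S o) (w o) p} := by
  have hT := h.passSet g hm hp hS hw p
  refine .union ?_ ((hT.measurableSet_mem hp).inter (hT.measurableSet_mem hm))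
  have := (h.refinePoint_toFinset g hm hp hT ((measurable_pi_apply p).comp hw)).measurable_card
    (measurableSet_singleton 0)
  refine this.congr ?_
  ext o
  simp only [Set.mem_preimage, Set.mem_singleton_iff, Option.card_toFinset, Function.comp]
  change _ ↔ refinePoint B A g (θm o) (θp o) _ (w o p) = none
  cases refinePoint B A g (θm o) (θp o) (LocalApproxMCMC.passSet B A g (θm o) (θp o) (S o) (w o) p)
    (w o p) <;> simp

theorem MeasurableData.finalSet (h : MeasurableData B A) (g : ℝ) {θm θp : Ω → E d}
    (hm : Measurable θm) (hp : Measurable θp) {S : Ω → Finset (E d)} (hS : FinsetMeasurable S)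
    {w : Ω → ℕ → ℝ × ℝ} (hw : Measurable w) :
    FinsetMeasurable fun o => finalSet B A g (θm o) (θp o) (S o) (w o) := by
  have hL := h.measurableSet_leaves g hm hp hS hw
  refine .iUnion (ι := ℕ)
    (c := fun p => {o | sInf {p | leaves B A g (θm o) (θp o) (S o) (w o) p} = p})
    (h.passSet g hm hp hS hw) (fun p => ?_) fun o x => by simp [LocalApproxMCMC.finalSet]
  -- The second alternative accounts for `sInf ∅ = 0`: a loop that is never left counts as left at
  -- pass `0`.
  have : {o | sInf {p | leaves B A g (θm o) (θp o) (S o) (w o) p} = p} =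
      {o | (leaves B A g (θm o) (θp o) (S o) (w o) p ∧
        ∀ j, j < p → ¬ leaves B A g (θm o) (θp o) (S o) (w o) j) ∨
      (p = 0 ∧ ∀ j, ¬ leaves B A g (θm o) (θp o) (S o) (w o) j)} := by
    ext o
    set s := {p | leaves B A g (θm o) (θp o) (S o) (w o) p} with hs
    change sInf s = p ↔ (p ∈ s ∧ ∀ j, j < p → j ∉ s) ∨ (p = 0 ∧ ∀ j, j ∉ s)
    rcases s.eq_empty_or_nonempty with h0 | h0
    · simp [h0, eq_comm]
    · constructor
      · rintro rfl
        exact .inl ⟨Nat.sInf_mem h0, fun j hj => Nat.notMem_of_lt_sInf hj⟩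
      · rintro (⟨h1, h2⟩ | ⟨-, h1⟩)
        · exact le_antisymm (Nat.sInf_le h1) (not_lt.1 fun hlt => h2 _ hlt (Nat.sInf_mem h0))
        · exact absurd h0.some_mem (h1 _)
  rw [this]
  refine .union (.inter (hL p) ?_) (.inter (.const _) ?_)
  · refine measurableSet_setOfPred.2 (.forall fun j => .imp measurable_const ?_)
    exact measurableSet_setOfPred.1 (hL j).compl
  · exact measurableSet_setOfPred.2 (.forall fun j => measurableSet_setOfPred.1 (hL j).compl)

theorem MeasurableData.chainStep_snd (h : MeasurableData B A) (g : ℝ) {θm : Ω → E d}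
    (hm : Measurable θm) {S : Ω → Finset (E d)} (hS : FinsetMeasurable S)
    {ξ : Ω → Noise Z} (hξ : Measurable ξ) :
    FinsetMeasurable fun o => (chainStep B A g (θm o) (S o) (ξ o)).2 :=
  h.finalSet g hm (h.proposal.comp (hm.prodMk hξ.fst)) hS hξ.snd.fst

theorem MeasurableData.chainStep_fst (h : MeasurableData B A) (g : ℝ) {θm : Ω → E d}
    (hm : Measurable θm) {S : Ω → Finset (E d)} (hS : FinsetMeasurable S)
    {ξ : Ω → Noise Z} (hξ : Measurable ξ) :
    Measurable fun o => (chainStep B A g (θm o) (S o) (ξ o)).1 := by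
  have hp := h.proposal.comp (hm.prodMk hξ.fst)
  exact .ite (measurableSet_lt hξ.snd.snd
    (h.accProb hm hp (h.finalSet g hm hp hS hξ.snd.fst))) hp hm

theorem MeasurableData.parallelRun (h : MeasurableData B A) {n : ℕ} (σ : ℕ → Finset (Fin n))
    (x₀ : Fin n → E d) (S₀ : Finset (E d)) (k : ℕ) :
    (∀ i, Measurable fun η => (parallelRun B A σ x₀ S₀ η k).X i) ∧
      FinsetMeasurable fun η => (parallelRun B A σ x₀ S₀ η k).S := by
  classical
  induction k with
  | zero => exact ⟨fun i => measurable_const, .const _⟩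
  | succ k ih =>
    refine ⟨fun i => ?_, ?_⟩
    · by_cases hi : i ∈ σ k
      · simp only [LocalApproxMCMC.parallelRun, if_pos hi]
        exact h.chainStep_fst _ (ih.1 i) ih.2 (measurable_pi_apply (k, i))
      · simp only [LocalApproxMCMC.parallelRun, if_neg hi]
        exact ih.1 i
    · simp only [LocalApproxMCMC.parallelRun]
      exact ih.2.union (.biUnion _ fun i _ =>
        h.chainStep_snd _ (ih.1 i) ih.2 (measurable_pi_apply (k, i)))

end Measurability

/-! ### Accuracy of the local approximation after refinement -/

section Accuracy

variable {d m : ℕ} {Z : Type*} {B : BayesProblem d m} {A : AlgParams d Z}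

theorem numCoeff_pos (d : ℕ) : 0 < numCoeff d :=
  Nat.div_pos (by nlinarith) (by norm_num)

theorem nearest_subset (θ : E d) (S : Finset (E d)) : nearest θ S ⊆ S := by
  classical
  exact Finset.filter_subset _ _

theorem mem_nearest_self {θ : E d} {S : Finset (E d)} (h : θ ∈ S) : θ ∈ nearest θ S := by
  classical
  simp [nearest, h, not_lt.2 dist_nonneg, numCoeff_pos]

/-- A sample point is among its own nearest points. If these are poised, the interpolant reproduces
the value at this node; otherwise the fit falls back on the known value. -/
theorem locApprox_eq_of_mem {θ : E d} {S : Finset (E d)} (h : θ ∈ S) :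
    locApprox B A θ S = B.logPost θ := by
  have h1 := mem_nearest_self h
  unfold locApprox fit
  split_ifs with h2
  · exact quadVal_interp h2 _ h1
  · rfl

/-- At least `N` points of `S` lie in the closed ball of radius `ρ` about `θ`. -/
def Surrounded (ρ : ℝ) (θ : E d) (S : Finset (E d)) : Prop :=
  ∃ T ⊆ S, numCoeff d ≤ T.card ∧ ∀ y ∈ T, dist y θ ≤ ρ

theorem Surrounded.mono {ρ : ℝ} {θ : E d} {S S' : Finset (E d)} (h : Surrounded ρ θ S)
    (hS : S ⊆ S') : Surrounded ρ θ S' :=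
  let ⟨T, hT, h'⟩ := h
  ⟨T, hT.trans hS, h'⟩

/-- A neighbour farther away than `ρ` would have at least `N` samples strictly closer to `θ`,
contrary to the selection rule. -/
theorem Surrounded.dist_le {ρ : ℝ} {θ : E d} {S : Finset (E d)} (h : Surrounded ρ θ S) {y : E d}
    (hy : y ∈ nearest θ S) : dist y θ ≤ ρ := by
  classical
  obtain ⟨T, hT, hc, hd⟩ := h
  by_contra! hlt
  have h1 := (Finset.mem_filter.1 hy).2
  have h2 : T ⊆ S.filter fun z => dist z θ < dist y θ := fun z hz =>
    Finset.mem_filter.2 ⟨hT hz, (hd z hz).trans_lt hlt⟩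
  exact absurd (hc.trans (Finset.card_le_card h2)) (not_le.2 (by convert h1))

/-- Since the Lagrange polynomials sum to one at `θ`, the error is the sum over neighbours `y` of
the Lagrange polynomial at `θ` times the difference of log-posteriors at `y` and `θ`. The factors
are at most `lam` and `η`, and a poised set has `quadDim d` points. -/
theorem abs_locApprox_sub_le {Θ : Set (E d)} {lam ρ η : ℝ}
    (hg : ∀ x ∈ Θ, ∀ y ∈ Θ, dist x y ≤ ρ → |B.logPost x - B.logPost y| ≤ η)
    {θ : E d} (hθ : θ ∈ Θ) {S : Finset (E d)} (hS : ∀ s ∈ S, s ∈ Θ) (hp : PoisedAt lam θ S)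
    (hs : Surrounded ρ θ S) :
    |locApprox B A θ S - B.logPost θ| ≤ quadDim d * (lam * η) := by
  obtain ⟨h1, h2⟩ := hp
  have h3 : locApprox B A θ S = ∑ y ∈ nearest θ S,
      B.logPost y * quadVal (lagrangePoly (nearest θ S) y) θ := by
    rw [locApprox, fit, if_pos h1, interp_eq_sum_lagrangePoly h1, quadVal_sum]
    simp only [quadVal_smul]
  have h4 : B.logPost θ = ∑ y ∈ nearest θ S,
      B.logPost θ * quadVal (lagrangePoly (nearest θ S) y) θ := by
    rw [← Finset.mul_sum, sum_lagrangePoly h1, mul_one]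
  rw [h3, h4]
  rw [← Finset.sum_sub_distrib, ← card_eq_quadDim_of_poised h1, ← nsmul_eq_mul]
  refine (Finset.abs_sum_le_sum_abs _ _).trans (Finset.sum_le_card_nsmul _ _ _ fun y hy => ?_)
  rw [← sub_mul, abs_mul, mul_comm lam]
  have h5 := hg y (hS y (nearest_subset _ _ hy)) θ hθ (hs.dist_le hy)
  exact mul_le_mul h5 (h2 y hy θ (Metric.mem_closedBall_self (NNReal.coe_nonneg _)))
    (abs_nonneg _) ((abs_nonneg _).trans h5)

/-- On the logarithmic scale the acceptance probability is `exp (min 0 x)`, a composition of maps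
that are 1-Lipschitz on the relevant ranges. -/
theorem abs_min_one_exp_sub_le (s t : ℝ) :
    |min 1 (Real.exp s) - min 1 (Real.exp t)| ≤ |s - t| := by
  wlog h : s ≤ t generalizing s t
  · rw [abs_sub_comm, abs_sub_comm s t]
    exact this t s (le_of_not_ge h)
  have h1 : ∀ x, min 1 (Real.exp x) = Real.exp (min 0 x) := fun x => by
    rw [← Real.exp_zero, Real.exp_monotone.map_min]
  rw [h1, h1, abs_sub_comm, abs_sub_comm s t, abs_of_nonneg (sub_nonneg.2 h), abs_of_nonneg
    (sub_nonneg.2 (Real.exp_le_exp.2 (min_le_min_left _ h)))]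
  set a := min 0 s
  set b := min 0 t
  have hab : b - a ≤ t - s := by
    simp only [a, b]
    rcases le_total 0 s with h2 | h2 <;> rcases le_total 0 t with h3 | h3 <;>
      simp only [min_eq_left, min_eq_right, h2, h3] <;> linarith
  have h2 : Real.exp a = Real.exp b * Real.exp (a - b) := by rw [← Real.exp_add]; ring_nf
  have h3 : Real.exp b ≤ 1 := Real.exp_le_one_iff.2 (min_le_left _ _)
  -- Gives `exp b - exp a ≤ exp b * (b - a) ≤ b - a`, because `b ≤ 0`.
  have h4 := Real.add_one_le_exp (a - b)
  have h5 : a ≤ b := min_le_min_left _ h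
  nlinarith [Real.exp_pos b]

theorem abs_min_one_mhRatio_sub_le {x y : E d} (hxy : 0 < A.q x y) (hyx : 0 < A.q y x)
    (ap am ap' am' : ℝ) : |min 1 (mhRatio A x y ap am) - min 1 (mhRatio A x y ap' am')| ≤
      |ap - ap'| + |am - am'| := by
  have h : ∀ a b, mhRatio A x y a b =
      Real.exp (a - b + (Real.log (A.q y x) - Real.log (A.q x y))) := by
    intro a b
    rw [mhRatio, Real.exp_add, Real.exp_sub, Real.exp_sub, Real.exp_log hxy, Real.exp_log hyx,
      mul_div_mul_comm]
  rw [h, h]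
  refine (abs_min_one_exp_sub_le _ _).trans ?_
  rw [add_sub_add_right_eq_sub, show ap - am - (ap' - am') = (ap - ap') - (am - am') by ring]
  exact abs_sub _ _

variable (B A) in
/-- The acceptance probability of the exact Metropolis–Hastings chain. -/
noncomputable def exactAcc (x y : E d) : ℝ :=
  min 1 (mhRatio A x y (B.logPost y) (B.logPost x))

/-- The values of the uniform variables of a pass that force refinement at the proposed point. -/
def refineProposal (β : ℝ) : Set (ℝ × ℝ) := {v | v.1 < β ∧ v.2 < 1 / 2}

/-- The values of the uniform variables of a pass that force refinement at the current point. -/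
def refineCurrent (β : ℝ) : Set (ℝ × ℝ) := {v | v.1 < β ∧ ¬ v.2 < 1 / 2}

/-- Each of the two random refinements occurs in some pass. -/
def BothRefined (β : ℝ) (w : ℕ → ℝ × ℝ) : Prop :=
  (∃ p, w p ∈ refineProposal β) ∧ ∃ p, w p ∈ refineCurrent β

variable {g : ℝ} {θm θp : E d} {S : Finset (E d)} {w : ℕ → ℝ × ℝ}

theorem passSet_mono : Monotone (passSet B A g θm θp S w) := by
  classical
  exact monotone_nat_of_le_succ fun p => by
    rw [passSet_succ]
    exact Finset.subset_union_left

theorem mem_passSet_succ_of_refineProposal {p : ℕ} (h : w p ∈ refineProposal A.β) :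
    θp ∈ passSet B A g θm θp S w (p + 1) := by
  classical
  rw [passSet_succ, refinePoint, if_pos h.1, if_pos h.2]
  simp

theorem mem_passSet_succ_of_refineCurrent {p : ℕ} (h : w p ∈ refineCurrent A.β) :
    θm ∈ passSet B A g θm θp S w (p + 1) := by
  classical
  rw [passSet_succ, refinePoint, if_pos h.1, if_neg h.2]
  simp

/-- Once both points have been refined they belong to the sample set, which is an exit condition
whatever the other tests say. -/
theorem BothRefined.exists_leaves (h : BothRefined A.β w) :
    ∃ p, leaves B A g θm θp S w p := by
  obtain ⟨⟨p, hp⟩, q, hq⟩ := h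
  exact ⟨max p q + 1, .inr ⟨passSet_mono (by simp) (mem_passSet_succ_of_refineProposal hp),
    passSet_mono (by simp) (mem_passSet_succ_of_refineCurrent hq)⟩⟩

theorem BothRefined.leaves_sInf (h : BothRefined A.β w) :
    leaves B A g θm θp S w (sInf {p | leaves B A g θm θp S w p}) :=
  Nat.sInf_mem (s := {p | leaves B A g θm θp S w p}) h.exists_leaves

theorem subset_finalSet : S ⊆ finalSet B A g θm θp S w :=
  passSet_mono (B := B) (A := A) (g := g) (θm := θm) (θp := θp) (S := S) (w := w) (Nat.zero_le _)

theorem mem_finalSet_imp {x : E d} (hx : x ∈ finalSet B A g θm θp S w) :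
    x ∈ S ∨ x = θp ∨ x = θm := by
  classical
  have : ∀ p, x ∈ passSet B A g θm θp S w p → x ∈ S ∨ x = θp ∨ x = θm := by
    intro p
    induction p with
    | zero => exact .inl
    | succ p ih =>
      rw [passSet_succ, Finset.mem_union]
      rintro (h | h)
      · exact ih h
      · right
        rw [Option.mem_toFinset, refinePoint] at h
        split_ifs at h <;> simp_all
  exact this _ hx

/-- A pass that adds nothing has found both poisedness tests satisfied; the only other way out of
the loop is that both points are samples. -/
theorem BothRefined.finalSet_spec (h : BothRefined A.β w) :
    (PoisedAt A.lam θp (finalSet B A g θm θp S w) ∧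
      PoisedAt A.lam θm (finalSet B A g θm θp S w)) ∨
    (θp ∈ finalSet B A g θm θp S w ∧ θm ∈ finalSet B A g θm θp S w) := by
  classical
  rcases h.leaves_sInf (B := B) (g := g) (θm := θm) (θp := θp) (S := S) with h | h
  · left
    change refinePoint B A g θm θp (finalSet B A g θm θp S w) _ = none at h
    rw [refinePoint] at h
    split_ifs at h with h1 h2 h3
    exact ⟨by_contra fun hc => h2 (.inr hc), by_contra fun hc => h3 (.inr hc)⟩
  · exact .inr h

/-- An exit at pass `0` returns the set from before that pass, so a point chosen there might seem
lost. But if that pass is a random refinement, the exit can only be due to both points being present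
already. -/
theorem BothRefined.passSet_one_subset_or (h : BothRefined A.β w) :
    (passSet B A g θm θp S w 1 ⊆ finalSet B A g θm θp S w) ∨ ¬ (w 0).1 < A.β ∨
      (θp ∈ finalSet B A g θm θp S w ∧ θm ∈ finalSet B A g θm θp S w) := by
  classical
  rcases Nat.eq_zero_or_pos (sInf {p | leaves B A g θm θp S w p}) with h0 | h0
  · right
    by_cases hw : (w 0).1 < A.β
    · right
      have := h.leaves_sInf (B := B) (g := g) (θm := θm) (θp := θp) (S := S)
      rcases this with h1 | h1
      · rw [h0, refinePoint, if_pos hw] at h1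
        cases h1
      · exact h1
    · exact .inl hw
  · exact .inl (passSet_mono h0)

theorem BothRefined.proposal_mem_finalSet (h : BothRefined A.β w)
    (hw : w 0 ∈ refineProposal A.β) : θp ∈ finalSet B A g θm θp S w := by
  rcases h.passSet_one_subset_or (B := B) (g := g) (θm := θm) (θp := θp) (S := S) with h1 | h1 | h1
  · exact h1 (mem_passSet_succ_of_refineProposal hw)
  · exact absurd hw.1 h1
  · exact h1.1

theorem BothRefined.current_mem_finalSet (h : BothRefined A.β w)
    (hw : w 0 ∈ refineCurrent A.β) : θm ∈ finalSet B A g θm θp S w := by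
  rcases h.passSet_one_subset_or (B := B) (g := g) (θm := θm) (θp := θp) (S := S) with h1 | h1 | h1
  · exact h1 (mem_passSet_succ_of_refineCurrent hw)
  · exact absurd hw.1 h1
  · exact h1.2

/-- Both exit conditions give accuracy at each point, and being surrounded or sampled survives the
enlargement of `S`. Only the current point is offered the alternative `θm ∈ S`: it may be an initial
state where samples do not accumulate. -/
theorem BothRefined.abs_accProb_sub_exactAcc_le {Θ : Set (E d)} {ρ η : ℝ} (hlam : 0 ≤ A.lam)
    (hη : 0 ≤ η)
    (hg : ∀ x ∈ Θ, ∀ y ∈ Θ, dist x y ≤ ρ → |B.logPost x - B.logPost y| ≤ η)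
    (hq : ∀ x ∈ Θ, ∀ y ∈ Θ, 0 < A.q x y) (hS : ∀ s ∈ S, s ∈ Θ) (hm : θm ∈ Θ) (hp : θp ∈ Θ)
    (hm' : Surrounded ρ θm S ∨ θm ∈ S) (hp' : Surrounded ρ θp S) (h : BothRefined A.β w) :
    |accProb B A θm θp (finalSet B A g θm θp S w) - exactAcc B A θm θp| ≤
      2 * (quadDim d * (A.lam * η)) := by
  set T := finalSet B A g θm θp S w with hT
  have hST : S ⊆ T := subset_finalSet
  have hTΘ : ∀ s ∈ T, s ∈ Θ := fun s hs => by
    rcases mem_finalSet_imp hs with h | rfl | rfl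
    exacts [hS s h, hp, hm]
  have h0 : 0 ≤ quadDim d * (A.lam * η) := by positivity
  have key : ∀ θ ∈ Θ, (PoisedAt A.lam θ T ∧ Surrounded ρ θ T) ∨ θ ∈ T →
      |locApprox B A θ T - B.logPost θ| ≤ quadDim d * (A.lam * η) := by
    rintro θ hθ (⟨h1, h2⟩ | h1)
    · exact abs_locApprox_sub_le hg hθ hTΘ h1 h2
    · rw [locApprox_eq_of_mem h1, sub_self, abs_zero]
      exact h0
  refine (abs_min_one_mhRatio_sub_le (hq _ hm _ hp) (hq _ hp _ hm) _ _ _ _).trans ?_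
  rw [two_mul]
  rcases h.finalSet_spec (B := B) (g := g) (θm := θm) (θp := θp) (S := S) with h1 | h1
  · exact add_le_add (key _ hp (.inl ⟨h1.1, hp'.mono hST⟩))
      (key _ hm (hm'.imp (fun h => ⟨h1.2, h.mono hST⟩) fun h => hST h))
  · exact add_le_add (key _ hp (.inr h1.1)) (key _ hm (.inr h1.2))

end Accuracy

/-! ### Total variation distance -/

section TotalVariation

variable {α : Type*} [MeasurableSpace α]

theorem abs_real_sub_le_one (μ π : Measure α) [IsProbabilityMeasure μ] [IsProbabilityMeasure π]
    (A : Set α) : |μ.real A - π.real A| ≤ 1 :=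
  abs_sub_le_of_nonneg_of_le measureReal_nonneg measureReal_le_one measureReal_nonneg
    measureReal_le_one

theorem abs_real_sub_le_tvDist (μ π : Measure α) [IsProbabilityMeasure μ] [IsProbabilityMeasure π]
    {A : Set α} (hA : MeasurableSet A) : |μ.real A - π.real A| ≤ tvDist μ π :=
  le_ciSup (f := fun A : {A : Set α // MeasurableSet A} => |μ.real (A : Set α) - π.real (A : Set α)|)
    ⟨1, by rintro _ ⟨A, rfl⟩; exact abs_real_sub_le_one μ π A⟩ ⟨A, hA⟩

theorem tvDist_nonneg (μ π : Measure α) : 0 ≤ tvDist μ π :=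
  Real.iSup_nonneg fun _ => abs_nonneg _

theorem tvDist_le {μ π : Measure α} {c : ℝ}
    (h : ∀ A, MeasurableSet A → |μ.real A - π.real A| ≤ c) : tvDist μ π ≤ c :=
  haveI : Nonempty {A : Set α // MeasurableSet A} := ⟨⟨∅, .empty⟩⟩
  ciSup_le fun A => h A A.2

/-- Layer cake: `f - a` is integrated through its superlevel sets over `(0, κ]`, and the two
measures of each such set differ by at most the total variation distance. That only the oscillation
`κ` of `f` enters is what makes a contraction possible. -/
theorem abs_integral_sub_le_tvDist (μ π : Measure α) [IsProbabilityMeasure μ]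
    [IsProbabilityMeasure π] {f : α → ℝ} (hf : Measurable f) {a κ : ℝ} (hκ : 0 ≤ κ)
    (hμ : ∀ᵐ x ∂μ, f x ∈ Set.Icc a (a + κ)) (hπ : ∀ᵐ x ∂π, f x ∈ Set.Icc a (a + κ)) :
    |∫ x, f x ∂μ - ∫ x, f x ∂π| ≤ κ * tvDist μ π := by
  have key : ∀ (ρ : Measure α) [IsProbabilityMeasure ρ], (∀ᵐ x ∂ρ, f x ∈ Set.Icc a (a + κ)) →
      ∫ x, f x ∂ρ - a = ∫ t in Set.Ioc 0 κ, ρ.real {x | t ≤ f x - a} := by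
    intro ρ _ h
    have hint : Integrable f ρ := .of_mem_Icc a (a + κ) hf.aemeasurable h
    have h1 := (hint.sub (integrable_const a)).integral_eq_integral_Ioc_meas_le (M := κ)
      (h.mono fun x hx => sub_nonneg.2 hx.1)
      (h.mono fun x hx => sub_le_iff_le_add'.2 hx.2)
    simp only [Pi.sub_apply] at h1
    rw [← h1, integral_sub hint (integrable_const a)]
    simp
  have hI : ∀ (ρ : Measure α) [IsProbabilityMeasure ρ],
      IntegrableOn (fun t => ρ.real {x | t ≤ f x - a}) (Set.Ioc 0 κ) := by
    intro ρ _
    have : Antitone fun t => ρ.real {x | t ≤ f x - a} := fun s t hst =>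
      measureReal_mono fun x hx => le_trans hst hx
    exact (this.antitoneOn _ |>.integrableOn_isCompact isCompact_Icc).mono_set
      Set.Ioc_subset_Icc_self
  have h2 : ∫ x, f x ∂μ - ∫ x, f x ∂π =
      ∫ t in Set.Ioc 0 κ, (μ.real {x | t ≤ f x - a} - π.real {x | t ≤ f x - a}) := by
    rw [integral_sub (hI μ) (hI π), ← key μ hμ, ← key π hπ]
    ring
  rw [h2, ← Real.norm_eq_abs]
  refine (norm_setIntegral_le_of_norm_le_const (C := tvDist μ π) (by simp) fun t _ => ?_).trans ?_
  · exact abs_real_sub_le_tvDist μ π (measurableSet_le measurable_const (hf.sub measurable_const))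
  · simp [hκ, mul_comm]

end TotalVariation

/-! ### The exact Metropolis–Hastings chain: invariance and contraction -/

section ExactChain

variable {d m : ℕ} {Z : Type*} [MeasurableSpace Z] {ν : Measure Z}
  {Θ : Set (E d)} {B : BayesProblem d m} {A : AlgParams d Z}

theorem SufficientConditions.measurableData (hA : SufficientConditions Θ B A ν) :
    MeasurableData B A :=
  ⟨hA.target_measurable, hA.proposal_measurable, hA.density_measurable, hA.alt_measurable⟩

theorem SufficientConditions.continuousOn_unnorm (hA : SufficientConditions Θ B A ν) :
    ContinuousOn B.unnorm Θ := by
  obtain ⟨F, hF, hFe⟩ := hA.target_smooth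
  exact hF.continuous.continuousOn.congr fun x hx => (hFe hx).symm

theorem SufficientConditions.unnorm_pos (hA : SufficientConditions Θ B A ν) {x : E d}
    (hx : x ∈ Θ) : 0 < B.unnorm x := by
  obtain ⟨c, hc, h⟩ := hA.target_lower
  exact hc.trans_le (h x hx)

theorem SufficientConditions.q_pos (hA : SufficientConditions Θ B A ν) {x y : E d}
    (hx : x ∈ Θ) (hy : y ∈ Θ) : 0 < A.q x y := by
  obtain ⟨c, hc, h⟩ := hA.proposal_lower
  exact hc.trans_le (h x hx y hy)

theorem SufficientConditions.exists_modulus (hA : SufficientConditions Θ B A ν) {η : ℝ}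
    (hη : 0 < η) : ∃ ρ > 0, ∀ x ∈ Θ, ∀ y ∈ Θ, dist x y ≤ ρ → |B.logPost x - B.logPost y| ≤ η := by
  have h1 : ContinuousOn B.logPost Θ :=
    hA.continuousOn_unnorm.log fun x hx => (hA.unnorm_pos hx).ne'
  have h2 := Metric.uniformContinuousOn_iff.1 (hA.compact.uniformContinuousOn_of_continuous h1) η hη
  obtain ⟨δ, hδ, h⟩ := h2
  exact ⟨δ / 2, half_pos hδ, fun x hx y hy hxy => (h x hx y hy (by linarith)).le⟩

theorem SufficientConditions.lintegral_proposal (hA : SufficientConditions Θ B A ν) {x : E d}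
    (hx : x ∈ Θ) {f : E d → ENNReal} (hf : Measurable f) :
    ∫⁻ z, f (A.r x z) ∂ν = ∫⁻ y in Θ, ENNReal.ofReal (A.q x y) * f y := by
  have hr : Measurable (A.r x) := hA.proposal_measurable.comp measurable_prodMk_left
  have hq : Measurable fun y => ENNReal.ofReal (A.q x y) :=
    (hA.density_measurable.comp measurable_prodMk_left).ennreal_ofReal
  rw [← lintegral_map hf hr, hA.proposal_law x hx, lintegral_withDensity_eq_lintegral_mul _ hq hf]
  rfl

theorem SufficientConditions.measurableSet (hA : SufficientConditions Θ B A ν) :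
    MeasurableSet Θ :=
  hA.compact.isClosed.measurableSet

theorem BayesProblem.posterior_apply {S : Set (E d)} (hS : MeasurableSet S) :
    B.posterior Θ S = ∫⁻ x in Θ,
      ENNReal.ofReal (B.unnorm x / ∫ x in Θ, B.unnorm x) * S.indicator 1 x := by
  rw [BayesProblem.posterior, withDensity_apply _ hS, ← lintegral_indicator hS]
  congr 1 with x
  by_cases hx : x ∈ S <;> simp [hx]

theorem noiseLaw_apply {T : Set (Noise Z)} (hT : MeasurableSet T) : noiseLaw ν T =
    ∫⁻ z, ((Measure.infinitePi fun _ : ℕ => unif.prod unif).prod unif) (Prod.mk z ⁻¹' T) ∂ν := by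
  rw [noiseLaw, Measure.prod_apply hT]

variable [IsProbabilityMeasure ν]

instance : IsProbabilityMeasure (noiseLaw ν) := by
  unfold noiseLaw
  infer_instance

theorem SufficientConditions.lintegral_q (hA : SufficientConditions Θ B A ν) {x : E d}
    (hx : x ∈ Θ) : ∫⁻ y in Θ, ENNReal.ofReal (A.q x y) = 1 := by
  simpa using (hA.lintegral_proposal hx (f := fun _ => 1) measurable_const).symm

/-- A null set could not carry the probability density `q x`. -/
theorem SufficientConditions.volume_pos (hA : SufficientConditions Θ B A ν) (hΘ : Θ.Nonempty) :
    0 < volume Θ := by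
  rw [pos_iff_ne_zero]
  intro h
  obtain ⟨x, hx⟩ := hΘ
  have := hA.lintegral_q hx
  rw [Measure.restrict_eq_zero.2 h] at this
  simp at this

omit [IsProbabilityMeasure ν] in
theorem SufficientConditions.integrableOn_unnorm (hA : SufficientConditions Θ B A ν) :
    IntegrableOn B.unnorm Θ :=
  hA.continuousOn_unnorm.integrableOn_compact hA.compact

theorem SufficientConditions.integral_unnorm_pos (hA : SufficientConditions Θ B A ν)
    (hΘ : Θ.Nonempty) : 0 < ∫ x in Θ, B.unnorm x := by
  rw [setIntegral_pos_iff_support_of_nonneg_ae]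
  · refine (hA.volume_pos hΘ).trans_le (measure_mono fun x hx => ⟨(hA.unnorm_pos hx).ne', hx⟩)
  · filter_upwards [ae_restrict_mem hA.measurableSet] with x hx using (hA.unnorm_pos hx).le
  · exact hA.integrableOn_unnorm

theorem SufficientConditions.isProbabilityMeasure_posterior (hA : SufficientConditions Θ B A ν)
    (hΘ : Θ.Nonempty) : IsProbabilityMeasure (B.posterior Θ) := by
  refine ⟨?_⟩
  have h := hA.integral_unnorm_pos hΘ
  rw [B.posterior_apply .univ]
  simp only [Set.indicator_univ, Pi.one_apply, mul_one]
  rw [← ofReal_integral_eq_lintegral_ofReal (hA.integrableOn_unnorm.div_const _),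
    integral_div, div_self h.ne', ENNReal.ofReal_one]
  filter_upwards [ae_restrict_mem hA.measurableSet] with x hx
    using div_nonneg (hA.unnorm_pos hx).le h.le

variable (B A) in
/-- The flow of the exact Metropolis–Hastings chain from `x` to `y`. -/
noncomputable def flow (x y : E d) : ℝ := min (B.unnorm x * A.q x y) (B.unnorm y * A.q y x)

omit [MeasurableSpace Z] in
theorem flow_comm (x y : E d) : flow B A x y = flow B A y x := min_comm _ _

-- Since `flow` is symmetric, this identity is detailed balance.
omit [IsProbabilityMeasure ν] in
theorem SufficientConditions.flow_eq (hA : SufficientConditions Θ B A ν) {x y : E d}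
    (hx : x ∈ Θ) (hy : y ∈ Θ) :
    flow B A x y = B.unnorm x * A.q x y * exactAcc B A x y := by
  have h1 := mul_pos (hA.unnorm_pos hx) (hA.q_pos hx hy)
  rw [flow, exactAcc, mhRatio, BayesProblem.logPost, BayesProblem.logPost,
    Real.exp_log (hA.unnorm_pos hx), Real.exp_log (hA.unnorm_pos hy),
    mul_min_of_nonneg _ _ h1.le, mul_one, mul_div_cancel₀ _ h1.ne']

omit [IsProbabilityMeasure ν] in
theorem SufficientConditions.exactAcc_nonneg (hA : SufficientConditions Θ B A ν) {x y : E d}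
    (hx : x ∈ Θ) (hy : y ∈ Θ) : 0 ≤ exactAcc B A x y :=
  le_min zero_le_one (div_nonneg (mul_nonneg (Real.exp_pos _).le (hA.q_pos hy hx).le)
    (mul_nonneg (Real.exp_pos _).le (hA.q_pos hx hy).le))

omit [MeasurableSpace Z] in
theorem exactAcc_le_one (x y : E d) : exactAcc B A x y ≤ 1 := min_le_left _ _

theorem MeasurableData.exactAcc (h : MeasurableData B A) {Ω : Type*} [MeasurableSpace Ω]
    {θm θp : Ω → E d} (hm : Measurable θm) (hp : Measurable θp) :
    Measurable fun o => exactAcc B A (θm o) (θp o) :=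
  measurable_const.min (h.mhRatio hm hp (h.logPost.comp hp) (h.logPost.comp hm))

theorem MeasurableData.flow (h : MeasurableData B A) :
    Measurable fun x : E d × E d => flow B A x.1 x.2 :=
  ((h.unnorm.comp measurable_fst).mul h.density).min
    ((h.unnorm.comp measurable_snd).mul (h.density.comp measurable_swap))

variable (B A) in
open scoped Classical in
/-- One step of the exact Metropolis–Hastings chain, driven by the noise `ξ`. -/
noncomputable def exactStep (x : E d) (ξ : Noise Z) : E d :=
  if ξ.2.2 < exactAcc B A x (A.r x ξ.1) then A.r x ξ.1 else x

theorem MeasurableData.exactStep (h : MeasurableData B A) :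
    Measurable fun p : E d × Noise Z => exactStep B A p.1 p.2 := by
  have hp : Measurable fun p : E d × Noise Z => A.r p.1 p.2.1 :=
    h.proposal.comp (measurable_fst.prodMk measurable_snd.fst)
  exact .ite (measurableSet_lt measurable_snd.snd.snd (h.exactAcc measurable_fst hp)) hp
    measurable_fst

theorem unif_setOf_lt {a : ℝ} (h1 : a ≤ 1) :
    unif {u | u < a} = ENNReal.ofReal a := by
  have hm : MeasurableSet {u : ℝ | u < a} := measurableSet_Iio
  rw [unif, Measure.restrict_apply hm]
  have : {u | u < a} ∩ Set.Icc 0 1 = Set.Ico 0 a := by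
    ext u
    simp only [Set.mem_inter_iff, Set.mem_ofPred_eq, Set.mem_Icc, Set.mem_Ico]
    exact ⟨fun h => ⟨h.2.1, h.1⟩, fun h => ⟨h.2, h.1, h.2.le.trans h1⟩⟩
  rw [this, Real.volume_Ico, sub_zero]

theorem unif_setOf_not_lt {a : ℝ} (h0 : 0 ≤ a) (h1 : a ≤ 1) :
    unif {u | ¬ u < a} = ENNReal.ofReal (1 - a) := by
  have : {u | ¬ u < a} = {u | u < a}ᶜ := rfl
  have hm : MeasurableSet {u : ℝ | u < a} := measurableSet_Iio
  rw [this, prob_compl_eq_one_sub hm, unif_setOf_lt h1,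
    ENNReal.ofReal_sub _ h0, ENNReal.ofReal_one]

open scoped Classical in
theorem unif_setOf_ite_mem {a : ℝ} (h0 : 0 ≤ a) (h1 : a ≤ 1) (x y : E d) (S : Set (E d)) :
    unif {u | (if u < a then y else x) ∈ S} =
      ENNReal.ofReal a * S.indicator 1 y + ENNReal.ofReal (1 - a) * S.indicator 1 x := by
  by_cases hy : y ∈ S <;> by_cases hx : x ∈ S
  · have : {u | (if u < a then y else x) ∈ S} = Set.univ := by
      ext u; by_cases hu : u < a <;> simp [hu, hx, hy]
    simp only [this, measure_univ, Set.indicator_of_mem hy, Set.indicator_of_mem hx, Pi.one_apply,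
      mul_one]
    rw [← ENNReal.ofReal_add h0 (by linarith)]
    simp
  · have : {u | (if u < a then y else x) ∈ S} = {u | u < a} := by
      ext u; by_cases hu : u < a <;> simp [hu, hx, hy]
    simp [this, hx, hy, unif_setOf_lt h1]
  · have : {u | (if u < a then y else x) ∈ S} = {u | ¬ u < a} := by
      ext u; by_cases hu : u < a <;> simp [hu, hx, hy, -not_lt]
    rw [this, unif_setOf_not_lt h0 h1]
    simp [hx, hy]
  · have : {u | (if u < a then y else x) ∈ S} = ∅ := by
      ext u; by_cases hu : u < a <;> simp [hu, hx, hy]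
    simp [this, hx, hy]

-- The exact step ignores the refinement noise. Integrating out the acceptance variable leaves the
-- usual kernel, with its accepted and rejected parts.
omit [IsProbabilityMeasure ν] in
theorem SufficientConditions.noiseLaw_exactStep (hA : SufficientConditions Θ B A ν) {x : E d}
    (hx : x ∈ Θ) {S : Set (E d)} (hS : MeasurableSet S) :
    noiseLaw ν {ξ | exactStep B A x ξ ∈ S} = ∫⁻ y in Θ, ENNReal.ofReal (A.q x y) *
      (ENNReal.ofReal (exactAcc B A x y) * S.indicator 1 y +
        ENNReal.ofReal (1 - exactAcc B A x y) * S.indicator 1 x) := by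
  classical
  have hM := hA.measurableData
  have h1 : MeasurableSet {ξ | exactStep B A x ξ ∈ S} :=
    (hM.exactStep.comp measurable_prodMk_left) hS
  let φ : E d → ENNReal := fun y => unif {u | (if u < exactAcc B A x y then y else x) ∈ S}
  have hφ : Measurable φ := by
    refine measurable_measure_prodMk_left (ν := unif)
      (s := {p : E d × ℝ | (if p.2 < exactAcc B A x p.1 then p.1 else x) ∈ S}) ?_
    exact (Measurable.ite (measurableSet_lt measurable_snd
      (hM.exactAcc measurable_const measurable_fst)) measurable_fst measurable_const) hS
  have h2 : noiseLaw ν {ξ | exactStep B A x ξ ∈ S} = ∫⁻ z, φ (A.r x z) ∂ν := by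
    rw [noiseLaw_apply h1]
    refine lintegral_congr fun z => ?_
    have : Prod.mk z ⁻¹' {ξ : Noise Z | exactStep B A x ξ ∈ S} = Set.univ ×ˢ
        {u | (if u < exactAcc B A x (A.r x z) then A.r x z else x) ∈ S} := by
      ext ⟨w, u⟩
      simp [exactStep]
    rw [this, Measure.prod_prod, measure_univ, one_mul]
  rw [h2, hA.lintegral_proposal hx hφ]
  refine setLIntegral_congr_fun hA.measurableSet fun y hy => ?_
  simp only [φ]
  rw [unif_setOf_ite_mem (hA.exactAcc_nonneg hx hy) (exactAcc_le_one _ _)]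

/-- The mass reaching `S` is the accepted flow into `S` plus the mass rejected in `S`. By symmetry
of the flow and Tonelli the inflow equals the outflow from `S`, and outflow plus rejected mass is
the posterior mass of `S` because `q x` integrates to one. -/
theorem SufficientConditions.lintegral_exactStep_posterior (hA : SufficientConditions Θ B A ν)
    (hΘ : Θ.Nonempty) {S : Set (E d)} (hS : MeasurableSet S) :
    ∫⁻ x, noiseLaw ν {ξ | exactStep B A x ξ ∈ S} ∂(B.posterior Θ) = B.posterior Θ S := by
  have hM := hA.measurableData
  set H := ∫ x in Θ, B.unnorm x
  have hHpos : 0 < H := hA.integral_unnorm_pos hΘ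
  have hmeas : Measurable fun x => noiseLaw ν {ξ | exactStep B A x ξ ∈ S} :=
    measurable_measure_prodMk_left (s := {p : E d × Noise Z | exactStep B A p.1 p.2 ∈ S})
      (hM.exactStep hS)
  have hdens : Measurable fun x => ENNReal.ofReal (B.unnorm x / H) :=
    (hM.unnorm.div_const _).ennreal_ofReal
  have hind : Measurable (S.indicator (1 : E d → ENNReal)) := measurable_one.indicator hS
  have hs : Measurable fun p : E d × E d => ENNReal.ofReal (flow B A p.1 p.2 / H) :=
    (hM.flow.div_const _).ennreal_ofReal
  have e1 : ∀ x ∈ Θ, ∀ y ∈ Θ, ENNReal.ofReal (B.unnorm x / H) * (ENNReal.ofReal (A.q x y) *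
      (ENNReal.ofReal (exactAcc B A x y) * S.indicator 1 y +
        ENNReal.ofReal (1 - exactAcc B A x y) * S.indicator 1 x)) =
      ENNReal.ofReal (flow B A x y / H) * S.indicator 1 y +
      ENNReal.ofReal ((B.unnorm x * A.q x y - flow B A x y) / H) * S.indicator 1 x := by
    intro x hx y hy
    have h1 : 0 ≤ B.unnorm x / H := div_nonneg (hA.unnorm_pos hx).le hHpos.le
    have h2 := (hA.q_pos hx hy).le
    rw [← mul_assoc, ← ENNReal.ofReal_mul h1, mul_add, ← mul_assoc, ← mul_assoc,
      ← ENNReal.ofReal_mul (mul_nonneg h1 h2), ← ENNReal.ofReal_mul (mul_nonneg h1 h2),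
      hA.flow_eq hx hy]
    congr 3 <;> ring
  have e2 : ∀ x ∈ Θ, ∀ y ∈ Θ, ENNReal.ofReal (flow B A x y / H) * S.indicator 1 x +
      ENNReal.ofReal ((B.unnorm x * A.q x y - flow B A x y) / H) * S.indicator 1 x =
      ENNReal.ofReal (B.unnorm x / H) * S.indicator 1 x * ENNReal.ofReal (A.q x y) := by
    intro x hx y hy
    have h1 : 0 ≤ B.unnorm x / H := div_nonneg (hA.unnorm_pos hx).le hHpos.le
    have h3 : 0 ≤ flow B A x y := le_min
      (mul_pos (hA.unnorm_pos hx) (hA.q_pos hx hy)).le (mul_pos (hA.unnorm_pos hy) (hA.q_pos hy hx)).le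
    have h4 : flow B A x y ≤ B.unnorm x * A.q x y := min_le_left _ _
    rw [← add_mul, ← ENNReal.ofReal_add (div_nonneg h3 hHpos.le)
      (div_nonneg (sub_nonneg.2 h4) hHpos.le), mul_right_comm, ← ENNReal.ofReal_mul h1]
    congr 2
    ring
  rw [B.posterior_apply hS, BayesProblem.posterior,
    lintegral_withDensity_eq_lintegral_mul _ hdens hmeas]
  calc ∫⁻ x in Θ, ENNReal.ofReal (B.unnorm x / H) * noiseLaw ν {ξ | exactStep B A x ξ ∈ S}
      = ∫⁻ x in Θ, ∫⁻ y in Θ, (ENNReal.ofReal (flow B A x y / H) * S.indicator 1 y +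
        ENNReal.ofReal ((B.unnorm x * A.q x y - flow B A x y) / H) * S.indicator 1 x) := by
        refine setLIntegral_congr_fun hA.measurableSet fun x hx => ?_
        beta_reduce
        rw [hA.noiseLaw_exactStep hx hS, ← lintegral_const_mul' _ _ ENNReal.ofReal_ne_top]
        exact setLIntegral_congr_fun hA.measurableSet fun y hy => e1 x hx y hy
    _ = ∫⁻ x in Θ, ((∫⁻ y in Θ, ENNReal.ofReal (flow B A x y / H) * S.indicator 1 y) +
        ∫⁻ y in Θ, ENNReal.ofReal ((B.unnorm x * A.q x y - flow B A x y) / H) *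
          S.indicator 1 x) := by
        refine lintegral_congr fun x => lintegral_add_left ?_ _
        exact (hs.comp measurable_prodMk_left).mul hind
    _ = (∫⁻ x in Θ, ∫⁻ y in Θ, ENNReal.ofReal (flow B A x y / H) * S.indicator 1 y) +
        ∫⁻ x in Θ, ∫⁻ y in Θ, ENNReal.ofReal ((B.unnorm x * A.q x y - flow B A x y) / H) *
          S.indicator 1 x := by
        refine lintegral_add_left ?_ _
        exact (hs.mul (hind.comp measurable_snd)).lintegral_prod_right'
    _ = (∫⁻ x in Θ, ∫⁻ y in Θ, ENNReal.ofReal (flow B A x y / H) * S.indicator 1 x) +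
        ∫⁻ x in Θ, ∫⁻ y in Θ, ENNReal.ofReal ((B.unnorm x * A.q x y - flow B A x y) / H) *
          S.indicator 1 x := by
        congr 1
        -- Detailed balance enters here: exchanging `x` and `y` turns flow into `S` into flow out of
        -- `S`.
        rw [lintegral_lintegral_swap (hs.mul (hind.comp measurable_snd)).aemeasurable]
        refine lintegral_congr fun y => lintegral_congr fun x => ?_
        rw [flow_comm]
    _ = ∫⁻ x in Θ, ((∫⁻ y in Θ, ENNReal.ofReal (flow B A x y / H) * S.indicator 1 x) +
        ∫⁻ y in Θ, ENNReal.ofReal ((B.unnorm x * A.q x y - flow B A x y) / H) *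
          S.indicator 1 x) := by
        refine (lintegral_add_left ?_ _).symm
        exact (hs.mul (hind.comp measurable_fst)).lintegral_prod_right'
    _ = ∫⁻ x in Θ, ENNReal.ofReal (B.unnorm x / H) * S.indicator 1 x := by
        refine setLIntegral_congr_fun hA.measurableSet fun x hx => ?_
        beta_reduce
        have hx1 : Measurable fun y => ENNReal.ofReal (flow B A x y / H) *
            S.indicator (1 : E d → ENNReal) x := (hs.comp measurable_prodMk_left).mul_const _
        have hx2 : Measurable fun y => ENNReal.ofReal (A.q x y) :=
          (hA.density_measurable.comp measurable_prodMk_left).ennreal_ofReal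
        rw [← lintegral_add_left hx1,
          setLIntegral_congr_fun hA.measurableSet (fun y hy => e2 x hx y hy),
          lintegral_const_mul _ hx2,
          hA.lintegral_q hx, mul_one]

theorem SufficientConditions.exists_minorization (hA : SufficientConditions Θ B A ν)
    (hΘ : Θ.Nonempty) : ∃ c > 0, ∀ x ∈ Θ, ∀ S, MeasurableSet S →
      c * volume.real (S ∩ Θ) ≤ (noiseLaw ν).real {ξ | exactStep B A x ξ ∈ S} := by
  obtain ⟨c, hc, hq⟩ := hA.proposal_lower
  obtain ⟨l, hl, hlow⟩ := hA.target_lower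
  obtain ⟨x₁, hx₁, hmax⟩ := hA.compact.exists_isMaxOn hΘ hA.continuousOn_unnorm
  set u := B.unnorm x₁
  have hu : 0 < u := hA.unnorm_pos hx₁
  -- The flow is at least `l * c` and equals `h x * q x y * exactAcc`, with `h x ≤ u`; dividing by
  -- `u` bounds the density of accepted moves from below.
  refine ⟨l * c / u, by positivity, fun x hx S hS => ?_⟩
  have hb : ∀ y ∈ Θ, l * c / u ≤ A.q x y * exactAcc B A x y := by
    intro y hy
    have h1 : l * c ≤ flow B A x y := le_min
      (mul_le_mul (hlow x hx) (hq x hx y hy) hc.le (hA.unnorm_pos hx).le)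
      (mul_le_mul (hlow y hy) (hq y hy x hx) hc.le (hA.unnorm_pos hy).le)
    rw [hA.flow_eq hx hy] at h1
    rw [div_le_iff₀' hu]
    refine h1.trans ?_
    rw [mul_assoc]
    exact mul_le_mul_of_nonneg_right (hmax hx)
      (mul_nonneg (hA.q_pos hx hy).le (hA.exactAcc_nonneg hx hy))
  have h2 : ENNReal.ofReal (l * c / u) * volume (S ∩ Θ) ≤
      noiseLaw ν {ξ | exactStep B A x ξ ∈ S} := by
    rw [hA.noiseLaw_exactStep hx hS, ← Measure.restrict_apply hS, ← lintegral_indicator_const hS]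
    refine setLIntegral_mono' hA.measurableSet fun y hy => ?_
    rw [mul_add, ← mul_assoc, ← ENNReal.ofReal_mul (hA.q_pos hx hy).le]
    refine le_trans ?_ le_self_add
    by_cases hyS : y ∈ S
    · simpa [hyS] using ENNReal.ofReal_le_ofReal (hb y hy)
    · simp [hyS]
  have h3 := ENNReal.toReal_mono (measure_ne_top _ _) h2
  rwa [ENNReal.toReal_mul, ENNReal.toReal_ofReal (by positivity)] at h3

/-- The exact Metropolis–Hastings chain contracts the total variation distance to its target. -/
theorem SufficientConditions.exists_contraction (hA : SufficientConditions Θ B A ν)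
    (hΘ : Θ.Nonempty) : ∃ κ, 0 ≤ κ ∧ κ < 1 ∧ ∀ μ : Measure (E d), IsProbabilityMeasure μ →
      (∀ᵐ x ∂μ, x ∈ Θ) → ∀ S, MeasurableSet S →
      |∫ x, (noiseLaw ν).real {ξ | exactStep B A x ξ ∈ S} ∂μ - (B.posterior Θ).real S| ≤
        κ * tvDist μ (B.posterior Θ) := by
  have hM := hA.measurableData
  have hprob := hA.isProbabilityMeasure_posterior hΘ
  obtain ⟨c, hc, hmin⟩ := hA.exists_minorization hΘ
  have hfin : volume Θ ≠ ⊤ := hA.compact.measure_lt_top.ne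
  have hV : 0 < volume.real Θ := ENNReal.toReal_pos (hA.volume_pos hΘ).ne' hfin
  have hle : c * volume.real Θ ≤ 1 := by
    obtain ⟨x, hx⟩ := hΘ
    have := hmin x hx Set.univ .univ
    rw [Set.univ_inter] at this
    exact this.trans measureReal_le_one
  refine ⟨1 - c * volume.real Θ, by linarith, by nlinarith, fun μ _ hμ S hS => ?_⟩
  set f : E d → ℝ := fun x => (noiseLaw ν).real {ξ | exactStep B A x ξ ∈ S} with hf
  have hmeas0 : Measurable fun x => noiseLaw ν {ξ | exactStep B A x ξ ∈ S} :=
    measurable_measure_prodMk_left (s := {p : E d × Noise Z | exactStep B A p.1 p.2 ∈ S})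
      (hM.exactStep hS)
  have hmeas : Measurable f := hmeas0.ennreal_toReal
  have hπ : ∫ x, f x ∂(B.posterior Θ) = (B.posterior Θ).real S := by
    rw [hf]
    simp only [Measure.real]
    rw [integral_toReal hmeas0.aemeasurable (by simp),
      hA.lintegral_exactStep_posterior hΘ hS]
  -- Minorization on `S` bounds `f` from below, and on the complement of `S` from above. The gap is
  -- `1 - c * volume.real Θ` whatever `S` is.
  have hmem : ∀ x ∈ Θ, f x ∈ Set.Icc (c * volume.real (S ∩ Θ))
      (c * volume.real (S ∩ Θ) + (1 - c * volume.real Θ)) := by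
    intro x hx
    refine ⟨hmin x hx S hS, ?_⟩
    have h1 := hmin x hx Sᶜ hS.compl
    have h2 : (noiseLaw ν).real {ξ | exactStep B A x ξ ∈ Sᶜ} = 1 - f x :=
      probReal_compl_eq_one_sub ((hM.exactStep.comp measurable_prodMk_left) hS)
    have h3 : volume.real (S ∩ Θ) + volume.real (Sᶜ ∩ Θ) = volume.real Θ := by
      rw [Set.inter_comm, Set.inter_comm _ Θ, ← Set.sdiff_eq]
      exact measureReal_inter_add_sdiff hS hfin
    rw [h2] at h1
    have h4 := congrArg (c * ·) h3
    simp only [mul_add] at h4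
    linarith
  rw [← hπ]
  refine abs_integral_sub_le_tvDist μ (B.posterior Θ) hmeas (by linarith)
    (hμ.mono hmem) (Eventually.mono ?_ hmem)
  exact (withDensity_absolutelyContinuous _ _).ae_le (ae_restrict_mem hA.measurableSet)

end ExactChain

/-! ### Recursive inequalities for real sequences -/

section Sequences

/-- Monotonicity gives a limit `l ≥ 0`; passing to the limit along the contracting indices yields `l
≤ κ * l`, so `l = 0`. -/
theorem tendsto_zero_of_contraction {a : ℕ → ℝ} {κ : ℝ} (ha : ∀ k, 0 ≤ a k) (hκ : κ < 1)
    (hmono : ∀ᶠ k in atTop, a (k + 1) ≤ a k) (hfreq : ∃ᶠ k in atTop, a (k + 1) ≤ κ * a k) :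
    Tendsto a atTop (𝓝 0) := by
  obtain ⟨K, hK⟩ := eventually_atTop.1 hmono
  have hanti : Antitone fun k => a (k + K) := antitone_nat_of_succ_le fun k => by
    have := hK (k + K) (Nat.le_add_left _ _)
    rwa [add_right_comm] at this
  have hbdd : BddBelow (Set.range fun k => a (k + K)) := ⟨0, by rintro _ ⟨k, rfl⟩; exact ha _⟩
  obtain ⟨l, hl⟩ : ∃ l, Tendsto a atTop (𝓝 l) :=
    ⟨_, (tendsto_add_atTop_iff_nat K).1 (tendsto_atTop_ciInf hanti hbdd)⟩
  have h0 : 0 ≤ l := ge_of_tendsto' hl ha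
  have h1 : l ≤ κ * l := le_of_tendsto_of_tendsto_of_frequently
    ((tendsto_add_atTop_iff_nat 1).2 hl) (hl.const_mul κ) hfreq
  have : l = 0 := by nlinarith
  rwa [this] at hl

/-- Once `e k ≤ (1 - κ) * δ`, the excess `max (a k - δ) 0` contracts without perturbation, so the
previous lemma applies to it for every `δ > 0`. Arbitrarily long gaps in `T` are harmless. -/
theorem tendsto_zero_of_perturbed_contraction {a e : ℕ → ℝ} {κ : ℝ} {T : Set ℕ}
    (hT : T.Infinite) (ha : ∀ k, 0 ≤ a k) (hκ0 : 0 ≤ κ) (hκ : κ < 1)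
    (he : Tendsto e atTop (𝓝 0)) (hin : ∀ k ∈ T, a (k + 1) ≤ κ * a k + e k)
    (hout : ∀ k ∉ T, a (k + 1) ≤ a k) : Tendsto a atTop (𝓝 0) := by
  have key : ∀ δ > 0, ∀ᶠ k in atTop, a k < 2 * δ := by
    intro δ hδ
    have h1 : ∀ᶠ k in atTop, e k ≤ (1 - κ) * δ :=
      (he.eventually_lt_const (mul_pos (by linarith) hδ)).mono fun k hk => hk.le
    have h2 : ∀ k ∈ T, e k ≤ (1 - κ) * δ → max (a (k + 1) - δ) 0 ≤ κ * max (a k - δ) 0 := by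
      intro k hk hek
      refine max_le ?_ (mul_nonneg hκ0 (le_max_right _ _))
      have h3 := hin k hk
      have h4 := mul_le_mul_of_nonneg_left (le_max_left (a k - δ) 0) hκ0
      linarith
    have hb : Tendsto (fun k => max (a k - δ) 0) atTop (𝓝 0) := by
      refine tendsto_zero_of_contraction (fun k => le_max_right _ _) hκ ?_ ?_
      · filter_upwards [h1] with k hk
        by_cases hkT : k ∈ T
        · refine (h2 k hkT hk).trans ?_
          have : 0 ≤ max (a k - δ) 0 := le_max_right _ _
          nlinarith
        · exact max_le_max_right _ (sub_le_sub_right (hout k hkT) _)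
      · exact ((Nat.frequently_atTop_iff_infinite.2 hT).and_eventually h1).mono
          fun k hk => h2 k hk.1 hk.2
    filter_upwards [hb.eventually_lt_const hδ] with k hk
    have := (le_max_left (a k - δ) 0).trans_lt hk
    linarith
  rw [Metric.tendsto_atTop]
  intro ε hε
  obtain ⟨K, hK⟩ := eventually_atTop.1 (key (ε / 2) (half_pos hε))
  refine ⟨K, fun k hk => ?_⟩
  have := hK k hk
  rw [Real.dist_eq, sub_zero, abs_of_nonneg (ha k)]
  linarith

end Sequences

/-! ### Probabilities of events of a single step -/

section Noise

variable {d m : ℕ} {Z : Type*} [MeasurableSpace Z] {ν : Measure Z}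
  {Θ : Set (E d)} {B : BayesProblem d m} {A : AlgParams d Z} {β : ℝ}

theorem measurableSet_refineProposal : MeasurableSet (refineProposal β) :=
  (measurableSet_lt measurable_fst measurable_const).inter
    (measurableSet_lt measurable_snd measurable_const)

theorem measurableSet_refineCurrent : MeasurableSet (refineCurrent β) :=
  (measurableSet_lt measurable_fst measurable_const).inter
    (measurableSet_lt measurable_snd measurable_const).compl

theorem unif_setOf_lt_pos {a : ℝ} (h : 0 < a) : 0 < unif {u | u < a} := by
  -- The threshold, applied later to `β`, may exceed `1`.
  have : unif {u | u < min a 1} ≤ unif {u | u < a} :=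
    measure_mono fun u (hu : u < min a 1) => show u < a from hu.trans_le (min_le_left _ _)
  refine lt_of_lt_of_le ?_ this
  rw [unif_setOf_lt (min_le_right _ _)]
  simpa using h

theorem refineProposal_pos (hβ : 0 < β) : 0 < (unif.prod unif) (refineProposal β) := by
  have : refineProposal β = {u | u < β} ×ˢ {u | u < 1 / 2} := rfl
  rw [this, Measure.prod_prod]
  exact ENNReal.mul_pos (unif_setOf_lt_pos hβ).ne' (unif_setOf_lt_pos (by norm_num)).ne'

theorem refineCurrent_pos (hβ : 0 < β) : 0 < (unif.prod unif) (refineCurrent β) := by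
  have : refineCurrent β = {u | u < β} ×ˢ {u | ¬ u < 1 / 2} := rfl
  rw [this, Measure.prod_prod]
  refine ENNReal.mul_pos (unif_setOf_lt_pos hβ).ne' ?_
  rw [unif_setOf_not_lt (by norm_num) (by norm_num)]
  norm_num

/-- The first `k` coordinates all miss `C` with probability `μ Cᶜ ^ k`, which tends to zero. -/
theorem ae_infinitePi_exists_mem {α : Type*} [MeasurableSpace α] (μ : Measure α)
    [IsProbabilityMeasure μ] {C : Set α} (hC : MeasurableSet C) (h : 0 < μ C) :
    ∀ᵐ w ∂(Measure.infinitePi fun _ : ℕ => μ), ∃ p, w p ∈ C := by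
  rw [ae_iff]
  have hlt : μ Cᶜ < 1 := by
    rw [prob_compl_eq_one_sub hC]
    exact ENNReal.sub_lt_self ENNReal.one_ne_top one_ne_zero h.ne'
  refine le_antisymm (ge_of_tendsto' (ENNReal.tendsto_pow_atTop_nhds_zero_of_lt_one hlt)
    fun k => ?_) bot_le
  have := Measure.infinitePi_pi (fun _ : ℕ => μ) (s := Finset.range k) (t := fun _ => Cᶜ)
    fun _ _ => hC.compl
  rw [Finset.prod_const, Finset.card_range] at this
  rw [← this]
  refine measure_mono fun w hw p _ hp => hw ⟨p, hp⟩

theorem infinitePi_eval_zero {α : Type*} [MeasurableSpace α] (μ : Measure α)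
    [IsProbabilityMeasure μ] {C : Set α} (hC : MeasurableSet C) :
    (Measure.infinitePi fun _ : ℕ => μ) {w | w 0 ∈ C} = μ C :=
  (measurePreserving_eval_infinitePi (fun _ : ℕ => μ) 0).measure_preimage hC.nullMeasurableSet

theorem ae_noiseLaw_bothRefined [IsProbabilityMeasure ν] (hβ : 0 < β) :
    ∀ᵐ ζ ∂(noiseLaw ν), BothRefined β ζ.2.1 := by
  have h := (ae_infinitePi_exists_mem (unif.prod unif) measurableSet_refineProposal
    (refineProposal_pos hβ)).and (ae_infinitePi_exists_mem (unif.prod unif)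
      measurableSet_refineCurrent (refineCurrent_pos hβ))
  exact Measure.quasiMeasurePreserving_snd.ae (Measure.quasiMeasurePreserving_fst.ae h)

theorem noiseLaw_refineCurrent [IsProbabilityMeasure ν] :
    noiseLaw ν {ζ | ζ.2.1 0 ∈ refineCurrent β} = (unif.prod unif) (refineCurrent β) := by
  have : {ζ : Noise Z | ζ.2.1 0 ∈ refineCurrent β} =
      Set.univ ×ˢ ({w | w 0 ∈ refineCurrent β} ×ˢ Set.univ) := by
    ext ζ; simp
  rw [this, noiseLaw, Measure.prod_prod, Measure.prod_prod, measure_univ, measure_univ, one_mul,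
    mul_one, infinitePi_eval_zero _ measurableSet_refineCurrent]

theorem noiseLaw_proposal_refineProposal (x : E d) (U : Set (E d)) :
    noiseLaw ν {ζ | A.r x ζ.1 ∈ U ∧ ζ.2.1 0 ∈ refineProposal β} =
      ν (A.r x ⁻¹' U) * (unif.prod unif) (refineProposal β) := by
  have : {ζ : Noise Z | A.r x ζ.1 ∈ U ∧ ζ.2.1 0 ∈ refineProposal β} =
      (A.r x ⁻¹' U) ×ˢ ({w | w 0 ∈ refineProposal β} ×ˢ Set.univ) := by
    ext ζ; simp
  rw [this, noiseLaw, Measure.prod_prod, Measure.prod_prod, measure_univ,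
    mul_one, infinitePi_eval_zero _ measurableSet_refineProposal]

/-- Given the proposal input, the uniform acceptance variable must fall into an interval of length
`2 * η`. -/
theorem noiseLaw_abs_sub_le [IsProbabilityMeasure ν] {f : Z → ℝ} (hf : Measurable f) (η : ℝ) :
    noiseLaw ν {ζ | |ζ.2.2 - f ζ.1| ≤ η} ≤ ENNReal.ofReal (2 * η) := by
  have hm : MeasurableSet {ζ : Noise Z | |ζ.2.2 - f ζ.1| ≤ η} :=
    measurableSet_le (measurable_norm.comp (measurable_snd.snd.sub (hf.comp measurable_fst)))
      measurable_const
  rw [noiseLaw_apply hm]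
  refine (lintegral_mono (g := fun _ => ENNReal.ofReal (2 * η)) fun z => ?_).trans (by simp)
  have : Prod.mk z ⁻¹' {ζ : Noise Z | |ζ.2.2 - f ζ.1| ≤ η} =
      Set.univ ×ˢ Metric.closedBall (f z) η := by
    ext ⟨w, u⟩
    simp [Real.dist_eq]
  rw [this, Measure.prod_prod, measure_univ, one_mul, ← Real.volume_closedBall (f z)]
  exact Measure.restrict_apply_le _ _

theorem SufficientConditions.measure_proposal (hA : SufficientConditions Θ B A ν) {x : E d}
    (hx : x ∈ Θ) {U : Set (E d)} (hU : MeasurableSet U) :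
    ν (A.r x ⁻¹' U) = ∫⁻ y in U ∩ Θ, ENNReal.ofReal (A.q x y) := by
  have hr : Measurable (A.r x) := hA.proposal_measurable.comp measurable_prodMk_left
  rw [← Measure.map_apply hr hU, hA.proposal_law x hx, withDensity_apply _ hU,
    Measure.restrict_restrict hU]

theorem SufficientConditions.exists_le_measure_proposal (hA : SufficientConditions Θ B A ν) :
    ∃ c : ENNReal, 0 < c ∧ ∀ x ∈ Θ, ∀ U, MeasurableSet U →
      c * volume (U ∩ Θ) ≤ ν (A.r x ⁻¹' U) := by
  obtain ⟨c, hc, hq⟩ := hA.proposal_lower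
  refine ⟨ENNReal.ofReal c, by simpa using hc, fun x hx U hU => ?_⟩
  rw [hA.measure_proposal hx hU, ← setLIntegral_const]
  exact setLIntegral_mono' (hU.inter hA.measurableSet) fun y hy =>
    ENNReal.ofReal_le_ofReal (hq x hx y hy.2)

/-- The proposal law has a density with respect to Lebesgue measure on `Θ`, so it does not charge
the complement of the support. The rest of `Θ` may never be surrounded by samples. -/
theorem SufficientConditions.ae_proposal_mem_support (hA : SufficientConditions Θ B A ν) {x : E d}
    (hx : x ∈ Θ) : ∀ᵐ z ∂ν, A.r x z ∈ (volume.restrict Θ).support := by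
  have hK : MeasurableSet (volume.restrict Θ).supportᶜ :=
    Measure.isClosed_support.measurableSet.compl
  change ν (A.r x ⁻¹' (volume.restrict Θ).supportᶜ) = 0
  rw [hA.measure_proposal hx hK, ← Measure.restrict_restrict hK]
  exact setLIntegral_measure_zero _ _ Measure.measure_compl_support

theorem SufficientConditions.support_subset (hA : SufficientConditions Θ B A ν) :
    (volume.restrict Θ).support ⊆ Θ :=
  Measure.support_subset_of_isClosed hA.compact.isClosed (ae_restrict_mem hA.measurableSet)

end Noise

/-! ### Independence of the current noise from the past -/

section Independence

variable {d m n : ℕ} {Z : Type*} [MeasurableSpace Z] {ν : Measure Z} [IsProbabilityMeasure ν]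
  {Θ : Set (E d)} {B : BayesProblem d m} {A : AlgParams d Z}
  {σ : ℕ → Finset (Fin n)} {x₀ : Fin n → E d} {S₀ : Finset (E d)}
  {Ω : Type*} [MeasurableSpace Ω] {P : Measure Ω} [IsProbabilityMeasure P]
  {ξ : ℕ × Fin n → Ω → Noise Z}

omit [MeasurableSpace Z] in
theorem parallelRun_congr {η η' : ℕ × Fin n → Noise Z} {k : ℕ}
    (h : ∀ a : ℕ × Fin n, a.1 < k → η a = η' a) :
    parallelRun B A σ x₀ S₀ η k = parallelRun B A σ x₀ S₀ η' k := by
  induction k with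
  | zero => rfl
  | succ k ih =>
    have h1 := ih fun a ha => h a (ha.trans k.lt_succ_self)
    have h2 : ∀ i, η (k, i) = η' (k, i) := fun i => h (k, i) k.lt_succ_self
    simp only [parallelRun, h1, h2]

/-- The noise before time `k`, continued by a constant. -/
noncomputable def pastNoise (z₀ : Noise Z) (k : ℕ) (η : ℕ × Fin n → Noise Z) :
    ℕ × Fin n → Noise Z :=
  fun a => if a.1 < k then η a else z₀

theorem measurable_pastNoise (z₀ : Noise Z) (k : ℕ) :
    Measurable (pastNoise (n := n) z₀ k) := by
  refine measurable_pi_lambda _ fun a => ?_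
  by_cases h : a.1 < k
  · simp only [pastNoise, if_pos h]
    exact measurable_pi_apply a
  · simp only [pastNoise, if_neg h]
    exact measurable_const

-- With finitely many chains, the noise before time `k` has a finite index set, and it does not
-- contain `(k, i)`.
omit [IsProbabilityMeasure P] in
theorem indepFun_pastNoise (hmeas : ∀ a, Measurable (ξ a)) (hindep : iIndepFun ξ P)
    (z₀ : Noise Z) (k : ℕ) (i : Fin n) :
    IndepFun (fun w => pastNoise z₀ k fun a => ξ a w) (ξ (k, i)) P := by
  have h := hindep.indepFun_finset (Finset.range k ×ˢ Finset.univ) {(k, i)}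
    (by simp) hmeas
  let f : ((a : (Finset.range k ×ˢ Finset.univ : Finset (ℕ × Fin n))) → Noise Z) →
      ℕ × Fin n → Noise Z := fun v a =>
    if h : a.1 < k then v ⟨a, by simpa using h⟩ else z₀
  have hf : Measurable f := by
    refine measurable_pi_lambda _ fun a => ?_
    by_cases ha : a.1 < k
    · simp only [f, dif_pos ha]
      exact measurable_pi_apply _
    · simp only [f, dif_neg ha]
      exact measurable_const
  have h2 := h.comp hf (measurable_pi_apply
    (⟨(k, i), by simp⟩ : ({(k, i)} : Finset (ℕ × Fin n))))
  have h3 : (fun w => pastNoise z₀ k fun a => ξ a w) = f ∘ fun w a => ξ a w := by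
    funext w a
    by_cases ha : a.1 < k <;> simp [f, pastNoise, ha]
  rw [h3]
  exact h2

/-- The noise of a step is independent of the state in which the step starts. -/
theorem measure_run_noise (hmeas : ∀ a, Measurable (ξ a)) (hindep : iIndepFun ξ P)
    (hlaw : ∀ a, P.map (ξ a) = noiseLaw ν) (k : ℕ) (i : Fin n)
    {C : ParState d n → Noise Z → Prop}
    (hC : MeasurableSet {p : (ℕ × Fin n → Noise Z) × Noise Z |
      C (parallelRun B A σ x₀ S₀ p.1 k) p.2}) :
    P {w | C (parallelRun B A σ x₀ S₀ (fun a => ξ a w) k) (ξ (k, i) w)} =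
      ∫⁻ w, noiseLaw ν {ζ | C (parallelRun B A σ x₀ S₀ (fun a => ξ a w) k) ζ} ∂P := by
  obtain ⟨z₀⟩ : Nonempty (Noise Z) := (noiseLaw ν).nonempty_of_neZero
  -- `H` produces the same run up to time `k` as the full noise but is independent of `ξ (k, i)`, so
  -- the joint law is a product and Fubini applies.
  let H : Ω → ℕ × Fin n → Noise Z := fun w => pastNoise z₀ k fun a => ξ a w
  have hH : Measurable H := (measurable_pastNoise z₀ k).comp (measurable_pi_lambda _ hmeas)
  have hrun : ∀ w, parallelRun B A σ x₀ S₀ (H w) k =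
      parallelRun B A σ x₀ S₀ (fun a => ξ a w) k := fun w =>
    parallelRun_congr fun a ha => by simp [H, pastNoise, ha]
  have hmap := (indepFun_iff_map_prod_eq_prod_map_map hH.aemeasurable
    (hmeas (k, i)).aemeasurable).1 (indepFun_pastNoise hmeas hindep z₀ k i)
  rw [hlaw] at hmap
  have h1 : P {w | C (parallelRun B A σ x₀ S₀ (fun a => ξ a w) k) (ξ (k, i) w)} =
      P.map (fun w => (H w, ξ (k, i) w)) {p | C (parallelRun B A σ x₀ S₀ p.1 k) p.2} := by
    rw [Measure.map_apply (hH.prodMk (hmeas _)) hC]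
    simp only [Set.preimage, Set.mem_ofPred_eq, hrun]
  rw [h1, hmap, Measure.prod_apply hC, lintegral_map (measurable_measure_prodMk_left hC) hH]
  refine lintegral_congr fun w => ?_
  simp only [Set.preimage, Set.mem_ofPred_eq, hrun]

/-- A conditional probability estimate: given any state satisfying `D`, the fresh noise satisfies
`C` with probability at most `κ`. -/
theorem measure_run_noise_le (hmeas : ∀ a, Measurable (ξ a)) (hindep : iIndepFun ξ P)
    (hlaw : ∀ a, P.map (ξ a) = noiseLaw ν) (k : ℕ) (i : Fin n)
    {D : ParState d n → Prop} {C : ParState d n → Noise Z → Prop}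
    (hD : MeasurableSet {η | D (parallelRun B A σ x₀ S₀ η k)})
    (hC : MeasurableSet {p : (ℕ × Fin n → Noise Z) × Noise Z |
      C (parallelRun B A σ x₀ S₀ p.1 k) p.2}) {κ : ENNReal}
    (hκ : ∀ s, D s → noiseLaw ν {ζ | C s ζ} ≤ κ) :
    P {w | D (parallelRun B A σ x₀ S₀ (fun a => ξ a w) k) ∧
        C (parallelRun B A σ x₀ S₀ (fun a => ξ a w) k) (ξ (k, i) w)} ≤
      κ * P {w | D (parallelRun B A σ x₀ S₀ (fun a => ξ a w) k)} := by
  have hD' : MeasurableSet {w | D (parallelRun B A σ x₀ S₀ (fun a => ξ a w) k)} :=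
    (measurable_pi_lambda (fun w a => ξ a w) hmeas) hD
  rw [measure_run_noise hmeas hindep hlaw k i (C := fun s ζ => D s ∧ C s ζ)
    ((measurable_fst hD).inter hC), ← setLIntegral_const, ← lintegral_indicator hD']
  refine lintegral_mono fun w => ?_
  by_cases hw : D (parallelRun B A σ x₀ S₀ (fun a => ξ a w) k)
  · have : w ∈ {w | D (parallelRun B A σ x₀ S₀ (fun a => ξ a w) k)} := hw
    simp only [Set.indicator_of_mem this, hw, true_and]
    exact hκ _ hw
  · simp [hw]

end Independence

/-! ### Finitely many sets whose sampling surrounds every support point -/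

section Covering

variable {d m : ℕ} {Z : Type*} [MeasurableSpace Z] {ν : Measure Z}
  {Θ : Set (E d)} {B : BayesProblem d m} {A : AlgParams d Z}

/-- An open set meeting the support has positive measure, whereas in positive dimension finite sets
are null. In dimension zero points are not null, but there `N = 1`. -/
theorem exists_finset_subset_support (μ : Measure (E d)) (hμ : μ ≪ volume) {V : Set (E d)}
    (hV : IsOpen V) (hne : (V ∩ μ.support).Nonempty) :
    ∃ T : Finset (E d), (T : Set (E d)) ⊆ V ∩ μ.support ∧ T.card = numCoeff d := by
  obtain ⟨x, hx⟩ := hne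
  rcases d with _ | d
  · exact ⟨{x}, by simpa using hx, rfl⟩
  · refine Set.Infinite.exists_subset_card_eq (fun hfin => ?_) _
    have h1 : μ (V ∩ μ.support) = μ V := measure_inter_conull Measure.measure_compl_support
    have h2 : μ (V ∩ μ.support) = 0 := hμ (hfin.measure_zero _)
    exact ((Measure.mem_support_iff_forall x).1 hx.2 V (hV.mem_nhds hx.1)).ne' (h1 ▸ h2)

/-- Near each support point choose `N` distinct support points with disjoint open neighbourhoods;
intersected with the ball of radius `ρ / 2`, each has positive volume in `Θ`. Compactness of the
support leaves finitely many balls. Samples from the `N` sets of one ball are distinct by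
disjointness and within `ρ` of every point of the ball. -/
theorem SufficientConditions.exists_surrounding_family (hA : SufficientConditions Θ B A ν) {ρ : ℝ}
    (hρ : 0 < ρ) : ∃ 𝓤 : Finset (Set (E d)),
      (∀ U ∈ 𝓤, MeasurableSet U ∧ 0 < volume (U ∩ Θ)) ∧
      ∀ S : Finset (E d), (∀ U ∈ 𝓤, ∃ s ∈ S, s ∈ U) →
        ∀ θ ∈ (volume.restrict Θ).support, Surrounded ρ θ S := by
  classical
  set K := (volume.restrict Θ).support with hK
  have hex : ∀ x : E d, ∃ (T : Finset (E d)) (W : E d → Set (E d)), x ∈ K →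
      T.card = numCoeff d ∧ (∀ y ∈ T, y ∈ K ∧ y ∈ W y ∧ y ∈ Metric.ball x (ρ / 2)) ∧
      (∀ y, IsOpen (W y)) ∧ (T : Set (E d)).PairwiseDisjoint W := by
    intro x
    by_cases hx : x ∈ K
    · obtain ⟨T, hT, hc⟩ := exists_finset_subset_support (volume.restrict Θ)
        Measure.absolutelyContinuous_restrict (Metric.isOpen_ball (x := x) (ε := ρ / 2))
        ⟨x, Metric.mem_ball_self (half_pos hρ), hx⟩
      obtain ⟨W, hW, hd⟩ := T.finite_toSet.t2_separation
      exact ⟨T, W, fun _ => ⟨hc, fun y hy => ⟨(hT hy).2, (hW y).1, (hT hy).1⟩,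
        fun y => (hW y).2, hd⟩⟩
    · exact ⟨∅, fun _ => ∅, fun h => absurd h hx⟩
  choose T W hTW using hex
  have hcomp : IsCompact K := hA.compact.of_isClosed_subset Measure.isClosed_support hA.support_subset
  obtain ⟨t, htK, ht⟩ := hcomp.elim_nhds_subcover (fun x => Metric.ball x (ρ / 2))
    fun x _ => Metric.ball_mem_nhds x (half_pos hρ)
  refine ⟨t.biUnion fun x => (T x).image fun y => W x y ∩ Metric.ball x (ρ / 2), ?_, ?_⟩
  · intro U hU
    simp only [Finset.mem_biUnion, Finset.mem_image] at hU
    obtain ⟨x, hx, y, hy, rfl⟩ := hU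
    obtain ⟨-, h2, h3, -⟩ := hTW x (htK x hx)
    have hopen : IsOpen (W x y ∩ Metric.ball x (ρ / 2)) := (h3 y).inter Metric.isOpen_ball
    refine ⟨hopen.measurableSet, ?_⟩
    rw [← Measure.restrict_apply hopen.measurableSet]
    exact (Measure.mem_support_iff_forall y).1 (h2 y hy).1 _ (hopen.mem_nhds (h2 y hy).2)
  · intro S hS θ hθ
    obtain ⟨x, hx, hθx⟩ := Set.mem_iUnion₂.1 (ht hθ)
    obtain ⟨h1, h2, -, h4⟩ := hTW x (htK x hx)
    have hs : ∀ y : E d, ∃ s, y ∈ T x → s ∈ S ∧ s ∈ W x y ∩ Metric.ball x (ρ / 2) := by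
      intro y
      by_cases hy : y ∈ T x
      · obtain ⟨s, hs, hsU⟩ := hS (W x y ∩ Metric.ball x (ρ / 2))
          (Finset.mem_biUnion.2 ⟨x, hx, Finset.mem_image_of_mem _ hy⟩)
        exact ⟨s, fun _ => ⟨hs, hsU⟩⟩
      · exact ⟨y, fun h => absurd h hy⟩
    choose f hf using hs
    refine ⟨(T x).image f, ?_, ?_, ?_⟩
    · intro s hs
      obtain ⟨y, hy, rfl⟩ := Finset.mem_image.1 hs
      exact (hf y hy).1
    · rw [Finset.card_image_of_injOn, h1]
      intro y hy z hz hyz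
      by_contra hne
      refine Set.disjoint_left.1 (h4 hy hz hne) (hf y hy).2.1 ?_
      have := (hf z hz).2.1
      rwa [← hyz] at this
    · intro s hs
      obtain ⟨y, hy, rfl⟩ := Finset.mem_image.1 hs
      have h5 : dist (f y) x < ρ / 2 := (hf y hy).2.2
      have h6 : dist θ x < ρ / 2 := hθx
      linarith [dist_triangle_right (f y) θ x]

end Covering

/-! ### One time step of the parallel run -/

section Run

variable {d m n : ℕ} {Z : Type*} {B : BayesProblem d m} {A : AlgParams d Z}
  {σ : ℕ → Finset (Fin n)} {x₀ : Fin n → E d} {S₀ : Finset (E d)} {η : ℕ × Fin n → Noise Z}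
  {k : ℕ} {i : Fin n}

theorem subset_parallelRun_succ :
    (parallelRun B A σ x₀ S₀ η k).S ⊆ (parallelRun B A σ x₀ S₀ η (k + 1)).S :=
  Finset.subset_union_left

theorem chainStep_subset_parallelRun_succ (hi : i ∈ σ k) :
    (chainStep B A (A.γ (Nat.count (fun j => i ∈ σ j) k)) ((parallelRun B A σ x₀ S₀ η k).X i)
      (parallelRun B A σ x₀ S₀ η k).S (η (k, i))).2 ⊆ (parallelRun B A σ x₀ S₀ η (k + 1)).S := by
  classical
  intro x hx
  refine Finset.mem_union_right _ (Finset.mem_biUnion.2 ⟨i, hi, ?_⟩)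
  convert hx

theorem parallelRun_succ_X_of_mem (hi : i ∈ σ k) :
    (parallelRun B A σ x₀ S₀ η (k + 1)).X i =
      (chainStep B A (A.γ (Nat.count (fun j => i ∈ σ j) k)) ((parallelRun B A σ x₀ S₀ η k).X i)
        (parallelRun B A σ x₀ S₀ η k).S (η (k, i))).1 := by
  simp only [parallelRun, if_pos hi]

theorem parallelRun_succ_X_of_notMem (hi : i ∉ σ k) :
    (parallelRun B A σ x₀ S₀ η (k + 1)).X i = (parallelRun B A σ x₀ S₀ η k).X i := by
  simp only [parallelRun, if_neg hi]

theorem mem_parallelRun_succ {x : E d} (hx : x ∈ (parallelRun B A σ x₀ S₀ η (k + 1)).S) :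
    x ∈ (parallelRun B A σ x₀ S₀ η k).S ∨ ∃ i, x = (parallelRun B A σ x₀ S₀ η k).X i ∨
      x = A.r ((parallelRun B A σ x₀ S₀ η k).X i) (η (k, i)).1 := by
  classical
  rcases Finset.mem_union.1 hx with h | h
  · exact .inl h
  · obtain ⟨i, -, h⟩ := Finset.mem_biUnion.1 h
    rcases mem_finalSet_imp h with h | h | h
    exacts [.inl h, .inr ⟨i, .inr h⟩, .inr ⟨i, .inl h⟩]

theorem chainStep_fst_eq_or (g : ℝ) (x : E d) (S : Finset (E d)) (ζ : Noise Z) :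
    (chainStep B A g x S ζ).1 = A.r x ζ.1 ∨ (chainStep B A g x S ζ).1 = x := by
  unfold chainStep
  by_cases h : ζ.2.2 < accProb B A x (A.r x ζ.1) (finalSet B A g x (A.r x ζ.1) S ζ.2.1)
  · exact .inl (if_pos h)
  · exact .inr (if_neg h)

end Run

/-! ### Almost sure invariants and accumulation of samples -/

/-- The hypotheses on a run of parallel chains. -/
structure IsRun {d m n : ℕ} {Z : Type*} [MeasurableSpace Z] (ν : Measure Z) (Θ : Set (E d))
    (B : BayesProblem d m) (A : AlgParams d Z) (x₀ : Fin n → E d) (S₀ : Finset (E d))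
    {Ω : Type*} [MeasurableSpace Ω] (P : Measure Ω) (ξ : ℕ × Fin n → Ω → Noise Z) : Prop where
  cond : SufficientConditions Θ B A ν
  init (i : Fin n) : x₀ i ∈ Θ
  samples : ∀ s ∈ S₀, s ∈ Θ
  meas (a : ℕ × Fin n) : Measurable (ξ a)
  indep : iIndepFun ξ P
  law (a : ℕ × Fin n) : P.map (ξ a) = noiseLaw ν

section Convergence

variable {d m n : ℕ} {Z : Type*} [MeasurableSpace Z] {ν : Measure Z} [IsProbabilityMeasure ν]
  {Θ : Set (E d)} {B : BayesProblem d m} {A : AlgParams d Z}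
  {σ : ℕ → Finset (Fin n)} {x₀ : Fin n → E d} {S₀ : Finset (E d)}
  {Ω : Type*} [MeasurableSpace Ω] {P : Measure Ω} [IsProbabilityMeasure P]
  {ξ : ℕ × Fin n → Ω → Noise Z}

variable (σ) in
-- Collects all exceptional null sets once, so that later estimates can argue path by path.
theorem IsRun.ae_regular (h : IsRun ν Θ B A x₀ S₀ P ξ) :
    ∀ᵐ w ∂P, ∀ k, ((∀ i, (parallelRun B A σ x₀ S₀ (ξ · w) k).X i ∈ Θ) ∧
      ∀ s ∈ (parallelRun B A σ x₀ S₀ (ξ · w) k).S, s ∈ Θ) ∧ ∀ i,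
      BothRefined A.β (ξ (k, i) w).2.1 ∧
      A.r ((parallelRun B A σ x₀ S₀ (ξ · w) k).X i) (ξ (k, i) w).1 ∈
        (volume.restrict Θ).support := by
  have hM := h.cond.measurableData
  have h1 : ∀ k i, ∀ᵐ w ∂P, BothRefined A.β (ξ (k, i) w).2.1 := fun k i => by
    have := ae_noiseLaw_bothRefined (ν := ν) h.cond.β_pos
    rw [← h.law (k, i)] at this
    exact ae_of_ae_map (h.meas _).aemeasurable this
  -- Stated as an implication because the proposal law is known only from states in `Θ`; the premise
  -- is removed by the pathwise induction `hinv`.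
  have h2 : ∀ k i, ∀ᵐ w ∂P, (parallelRun B A σ x₀ S₀ (ξ · w) k).X i ∈ Θ →
      A.r ((parallelRun B A σ x₀ S₀ (ξ · w) k).X i) (ξ (k, i) w).1 ∈
        (volume.restrict Θ).support := fun k i => by
    have hX := (hM.parallelRun σ x₀ S₀ k).1 i
    have hm : MeasurableSet {p : (ℕ × Fin n → Noise Z) × Noise Z |
        ¬ ((parallelRun B A σ x₀ S₀ p.1 k).X i ∈ Θ →
          A.r ((parallelRun B A σ x₀ S₀ p.1 k).X i) p.2.1 ∈ (volume.restrict Θ).support)} := by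
      simp only [Classical.not_imp]
      exact ((hX.comp measurable_fst) h.cond.measurableSet).inter ((h.cond.proposal_measurable.comp
        ((hX.comp measurable_fst).prodMk measurable_snd.fst))
          Measure.isClosed_support.measurableSet).compl
    rw [ae_iff, measure_run_noise h.meas h.indep h.law k i (C := fun s ζ => ¬ (s.X i ∈ Θ →
      A.r (s.X i) ζ.1 ∈ (volume.restrict Θ).support)) hm]
    refine lintegral_eq_zero_of_ae_eq_zero (.of_forall fun w => ?_)
    by_cases hw : (parallelRun B A σ x₀ S₀ (ξ · w) k).X i ∈ Θ
    · have := Measure.quasiMeasurePreserving_fst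
        (ν := (Measure.infinitePi fun _ : ℕ => unif.prod unif).prod unif) |>.ae
          (h.cond.ae_proposal_mem_support hw)
      simp only [hw, true_imp_iff]
      exact this
    · simp [hw]
  filter_upwards [ae_all_iff.2 fun k => ae_all_iff.2 (h1 k),
    ae_all_iff.2 fun k => ae_all_iff.2 (h2 k)] with w hw1 hw2
  have hinv : ∀ k, (∀ i, (parallelRun B A σ x₀ S₀ (ξ · w) k).X i ∈ Θ) ∧
      ∀ s ∈ (parallelRun B A σ x₀ S₀ (ξ · w) k).S, s ∈ Θ := by
    intro k
    induction k with
    | zero => exact ⟨h.init, h.samples⟩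
    | succ k ih =>
      have hr := fun i => h.cond.support_subset (hw2 k i (ih.1 i))
      refine ⟨fun i => ?_, fun s hs => ?_⟩
      · by_cases hi : i ∈ σ k
        · rw [parallelRun_succ_X_of_mem hi]
          rcases chainStep_fst_eq_or (B := B) (A := A) (A.γ (Nat.count (fun j => i ∈ σ j) k))
            ((parallelRun B A σ x₀ S₀ (ξ · w) k).X i) (parallelRun B A σ x₀ S₀ (ξ · w) k).S
            (ξ (k, i) w) with h3 | h3
          · rw [h3]
            exact hr i
          · rw [h3]
            exact ih.1 i
        · rw [parallelRun_succ_X_of_notMem hi]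
          exact ih.1 i
      · rcases mem_parallelRun_succ hs with h3 | ⟨i, rfl | rfl⟩
        exacts [ih.2 s h3, ih.1 i, hr i]
  exact fun k => ⟨hinv k, fun i => ⟨hw1 k i, hw2 k i ((hinv k).1 i)⟩⟩

theorem toReal_one_sub_lt_one {p : ENNReal} (hp : 0 < p) : (1 - p).toReal < 1 := by
  rw [← ENNReal.toReal_one]
  exact ENNReal.toReal_strict_mono ENNReal.one_ne_top
    (ENNReal.sub_lt_self ENNReal.one_ne_top one_ne_zero hp.ne')

/-- The sample set eventually meets every set of positive measure. -/
theorem IsRun.tendsto_measure_disjoint (h : IsRun ν Θ B A x₀ S₀ P ξ) {i : Fin n}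
    (hσ : {k | i ∈ σ k}.Infinite) {U : Set (E d)} (hU : MeasurableSet U)
    (hpos : 0 < volume (U ∩ Θ)) :
    Tendsto (fun k => P.real {w | ∀ s ∈ (parallelRun B A σ x₀ S₀ (ξ · w) k).S, s ∉ U})
      atTop (𝓝 0) := by
  have hM := h.cond.measurableData
  obtain ⟨c, hc, hcU⟩ := h.cond.exists_le_measure_proposal
  -- A lower bound, valid from every state in `Θ`, for the probability that the proposal lies in `U`
  -- and the first pass refines at it.
  set p : ENNReal := c * volume (U ∩ Θ) * (unif.prod unif) (refineProposal A.β) with hp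
  have hp0 : 0 < p := ENNReal.mul_pos (ENNReal.mul_pos hc.ne' hpos.ne').ne'
    (refineProposal_pos h.cond.β_pos).ne'
  refine tendsto_zero_of_contraction (fun k => measureReal_nonneg) (toReal_one_sub_lt_one hp0)
    (.of_forall fun k => measureReal_mono fun w hw s hs => hw s (subset_parallelRun_succ hs)) ?_
  refine (Nat.frequently_atTop_iff_infinite.2 hσ).mono fun k hi => ?_
  have hX := (hM.parallelRun σ x₀ S₀ k).1 i
  have hS := (hM.parallelRun σ x₀ S₀ k).2
  have hD : MeasurableSet {η | (parallelRun B A σ x₀ S₀ η k).X i ∈ Θ ∧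
      ∀ s ∈ (parallelRun B A σ x₀ S₀ η k).S, s ∉ U} := by
    refine (hX h.cond.measurableSet).inter ?_
    refine (hS.measurableSet_exists (p := fun _ s => s ∈ U) (measurable_snd hU)).compl.congr ?_
    ext η
    simp
    rfl
  have hE : Measurable fun q : E d × Noise Z => A.r q.1 q.2.1 :=
    h.cond.proposal_measurable.comp (measurable_fst.prodMk measurable_snd.fst)
  have hF : MeasurableSet {ζ : Noise Z | ζ.2.1 0 ∈ refineProposal A.β} :=
    ((measurable_pi_apply 0).comp measurable_snd.fst) measurableSet_refineProposal
  have hC : MeasurableSet {q : (ℕ × Fin n → Noise Z) × Noise Z |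
      ¬ (A.r ((parallelRun B A σ x₀ S₀ q.1 k).X i) q.2.1 ∈ U ∧
        q.2.2.1 0 ∈ refineProposal A.β)} :=
    (((hE.comp ((hX.comp measurable_fst).prodMk measurable_snd)) hU).inter
      (measurable_snd hF)).compl
  have key := measure_run_noise_le (σ := σ) (x₀ := x₀) (S₀ := S₀) h.meas h.indep h.law k i
    (D := fun s => s.X i ∈ Θ ∧ ∀ x ∈ s.S, x ∉ U)
    (C := fun s ζ => ¬ (A.r (s.X i) ζ.1 ∈ U ∧ ζ.2.1 0 ∈ refineProposal A.β)) (κ := 1 - p) hD hC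
    (by
      rintro s ⟨hs, -⟩
      have hset : MeasurableSet {ζ : Noise Z | A.r (s.X i) ζ.1 ∈ U ∧
          ζ.2.1 0 ∈ refineProposal A.β} := ((hE.comp measurable_prodMk_left) hU).inter hF
      have : {ζ : Noise Z | ¬ (A.r (s.X i) ζ.1 ∈ U ∧ ζ.2.1 0 ∈ refineProposal A.β)} =
        {ζ : Noise Z | A.r (s.X i) ζ.1 ∈ U ∧ ζ.2.1 0 ∈ refineProposal A.β}ᶜ := rfl
      rw [this, prob_compl_eq_one_sub hset, noiseLaw_proposal_refineProposal]
      exact tsub_le_tsub_left (mul_le_mul_left (hcU _ hs U hU) _) _)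
  have h1 : P {w | ∀ s ∈ (parallelRun B A σ x₀ S₀ (ξ · w) (k + 1)).S, s ∉ U} ≤
      (1 - p) * P {w | ∀ s ∈ (parallelRun B A σ x₀ S₀ (ξ · w) k).S, s ∉ U} := by
    refine (measure_mono_ae ?_).trans (key.trans
      (mul_le_mul_right (measure_mono fun w hw => hw.2) _))
    filter_upwards [h.ae_regular σ] with w hw hdis
    refine ⟨⟨(hw k).1.1 i, fun s hs => hdis s (subset_parallelRun_succ hs)⟩, fun hcon => ?_⟩
    exact hdis _ (chainStep_subset_parallelRun_succ hi
      (((hw k).2 i).1.proposal_mem_finalSet hcon.2)) hcon.1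
  have h2 := ENNReal.toReal_mono
    (ENNReal.mul_ne_top (ENNReal.sub_ne_top ENNReal.one_ne_top) (measure_ne_top _ _)) h1
  rwa [ENNReal.toReal_mul] at h2

/-- A chain that has not yet reached the support of Lebesgue measure on `Θ` eventually has its state
in the sample set. -/
theorem IsRun.tendsto_measure_notMem (h : IsRun ν Θ B A x₀ S₀ P ξ) {i : Fin n}
    (hσ : {k | i ∈ σ k}.Infinite) :
    Tendsto (fun k => P.real {w | (parallelRun B A σ x₀ S₀ (ξ · w) k).X i ∉
        (volume.restrict Θ).support ∧ (parallelRun B A σ x₀ S₀ (ξ · w) k).X i ∉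
          (parallelRun B A σ x₀ S₀ (ξ · w) k).S}) atTop (𝓝 0) := by
  have hM := h.cond.measurableData
  set p : ENNReal := (unif.prod unif) (refineCurrent A.β) with hp
  have hp0 : 0 < p := refineCurrent_pos h.cond.β_pos
  have hK : MeasurableSet (volume.restrict Θ).support := Measure.isClosed_support.measurableSet
  have hstep : ∀ k, i ∈ σ k → P {w | (parallelRun B A σ x₀ S₀ (ξ · w) (k + 1)).X i ∉
        (volume.restrict Θ).support ∧ (parallelRun B A σ x₀ S₀ (ξ · w) (k + 1)).X i ∉
          (parallelRun B A σ x₀ S₀ (ξ · w) (k + 1)).S} ≤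
      (1 - p) * P {w | (parallelRun B A σ x₀ S₀ (ξ · w) k).X i ∉
        (volume.restrict Θ).support ∧ (parallelRun B A σ x₀ S₀ (ξ · w) k).X i ∉
          (parallelRun B A σ x₀ S₀ (ξ · w) k).S} := by
    intro k hi
    have hX := (hM.parallelRun σ x₀ S₀ k).1 i
    have hS := (hM.parallelRun σ x₀ S₀ k).2
    have hF : MeasurableSet {ζ : Noise Z | ζ.2.1 0 ∈ refineCurrent A.β} :=
      ((measurable_pi_apply 0).comp measurable_snd.fst) measurableSet_refineCurrent
    refine (measure_mono_ae ?_).trans (measure_run_noise_le (σ := σ) (x₀ := x₀) (S₀ := S₀)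
      h.meas h.indep h.law k i
      (D := fun s => s.X i ∉ (volume.restrict Θ).support ∧ s.X i ∉ s.S)
      (C := fun _ ζ => ¬ ζ.2.1 0 ∈ refineCurrent A.β) (κ := 1 - p)
      ((hX hK).compl.inter (hS.measurableSet_mem hX).compl) (measurable_snd hF).compl ?_)
    · filter_upwards [h.ae_regular σ] with w hw hbad
      have hbad1 := hbad.1
      have hbad2 := hbad.2
      rw [parallelRun_succ_X_of_mem hi] at hbad1 hbad2
      -- An accepted proposal lies in the support, so the bad event can persist only if the state
      -- stays put; then a first pass refining at the current point would put it into the sample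
      -- set.
      rcases chainStep_fst_eq_or (B := B) (A := A) (A.γ (Nat.count (fun j => i ∈ σ j) k))
        ((parallelRun B A σ x₀ S₀ (ξ · w) k).X i) (parallelRun B A σ x₀ S₀ (ξ · w) k).S
        (ξ (k, i) w) with h3 | h3
      · rw [h3] at hbad1
        exact absurd ((hw k).2 i).2 hbad1
      · rw [h3] at hbad1 hbad2
        refine ⟨⟨hbad1, fun hmem => hbad2 (subset_parallelRun_succ hmem)⟩, fun hcon => hbad2 ?_⟩
        exact chainStep_subset_parallelRun_succ hi (((hw k).2 i).1.current_mem_finalSet hcon)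
    · intro s _
      have : {ζ : Noise Z | ¬ ζ.2.1 0 ∈ refineCurrent A.β} =
        {ζ : Noise Z | ζ.2.1 0 ∈ refineCurrent A.β}ᶜ := rfl
      rw [this, prob_compl_eq_one_sub hF, noiseLaw_refineCurrent]
  have hreal : ∀ k, i ∈ σ k → _ := fun k hi => ENNReal.toReal_mono
    (ENNReal.mul_ne_top (ENNReal.sub_ne_top ENNReal.one_ne_top) (measure_ne_top _ _)) (hstep k hi)
  simp only [ENNReal.toReal_mul] at hreal
  refine tendsto_zero_of_contraction (fun k => measureReal_nonneg) (toReal_one_sub_lt_one hp0)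
    (.of_forall fun k => ?_) ((Nat.frequently_atTop_iff_infinite.2 hσ).mono hreal)
  by_cases hi : i ∈ σ k
  · exact (hreal k hi).trans (mul_le_of_le_one_left measureReal_nonneg
      (toReal_one_sub_lt_one hp0).le)
  · refine measureReal_mono fun w hw => ?_
    simp only [Set.mem_ofPred_eq, parallelRun_succ_X_of_notMem hi] at hw ⊢
    exact ⟨hw.1, fun hmem => hw.2 (subset_parallelRun_succ hmem)⟩

end Convergence

/-- The coupling inequality. -/
theorem abs_measureReal_sub_le {Ω : Type*} [MeasurableSpace Ω] (P : Measure Ω) [IsFiniteMeasure P]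
    {α : Type*} (f g : Ω → α) (S : Set α) :
    |P.real {w | f w ∈ S} - P.real {w | g w ∈ S}| ≤ P.real {w | f w ≠ g w} := by
  have key : ∀ f g : Ω → α, P.real {w | f w ∈ S} ≤ P.real {w | g w ∈ S} +
      P.real {w | f w ≠ g w} := fun f g => by
    refine (measureReal_mono (fun w hw => ?_)).trans (measureReal_union_le _ _)
    by_cases hfg : f w = g w
    · exact .inl (show g w ∈ S from hfg ▸ hw)
    · exact .inr hfg
  have h1 := key f g
  have h2 := key g f
  simp only [ne_comm (a := g _)] at h2
  rw [abs_le]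
  constructor <;> linarith

/-! ### Coupling with the exact chain and conclusion -/

section Convergence

variable {d m n : ℕ} {Z : Type*} [MeasurableSpace Z] {ν : Measure Z} [IsProbabilityMeasure ν]
  {Θ : Set (E d)} {B : BayesProblem d m} {A : AlgParams d Z}
  {σ : ℕ → Finset (Fin n)} {x₀ : Fin n → E d} {S₀ : Finset (E d)}
  {Ω : Type*} [MeasurableSpace Ω] {P : Measure Ω} [IsProbabilityMeasure P]
  {ξ : ℕ × Fin n → Ω → Noise Z}

variable (B A) in
/-- The error of the acceptance probability in a step of the approximate chain. -/
noncomputable def accError (g : ℝ) (x : E d) (S : Finset (E d)) (ζ : Noise Z) : ℝ :=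
  |accProb B A x (A.r x ζ.1) (finalSet B A g x (A.r x ζ.1) S ζ.2.1) - exactAcc B A x (A.r x ζ.1)|

/-- The error of the acceptance probability tends to zero in probability. -/
theorem IsRun.tendsto_measure_accError (h : IsRun ν Θ B A x₀ S₀ P ξ) {i : Fin n}
    (hσ : {k | i ∈ σ k}.Infinite) (g : ℕ → ℝ) {η : ℝ} (hη : 0 < η) :
    Tendsto (fun k => P.real {w | η < accError B A (g k)
      ((parallelRun B A σ x₀ S₀ (ξ · w) k).X i) (parallelRun B A σ x₀ S₀ (ξ · w) k).S
        (ξ (k, i) w)}) atTop (𝓝 0) := by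
  have hlam := h.cond.lam_pos
  set c : ℝ := 2 * (quadDim d * A.lam) with hc
  have hc0 : 0 ≤ c := by positivity
  -- The accuracy bound becomes `c * η / (c + 1) ≤ η`; the added `1` avoids showing `c ≠ 0`.
  obtain ⟨ρ, hρ, hmod⟩ := h.cond.exists_modulus (η := η / (c + 1)) (by positivity)
  obtain ⟨𝓤, h𝓤, hsur⟩ := h.cond.exists_surrounding_family hρ
  -- Outside a null set, a large error requires that some `U` contains no sample, or that the state
  -- is neither in the support nor sampled. Each of these finitely many events has vanishing
  -- probability.
  have hlim := (tendsto_finsetSum 𝓤 fun U hU =>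
    h.tendsto_measure_disjoint hσ (h𝓤 U hU).1 (h𝓤 U hU).2).add (h.tendsto_measure_notMem hσ)
  simp only [Finset.sum_const_zero, add_zero] at hlim
  refine squeeze_zero (fun _ => measureReal_nonneg) (fun k => ?_) hlim
  refine le_trans ?_ ((measureReal_union_le _ _).trans
    (add_le_add_left (measureReal_biUnion_finset_le 𝓤 _) _))
  refine ENNReal.toReal_mono (measure_ne_top _ _) (measure_mono_ae ?_)
  filter_upwards [h.ae_regular σ] with w hw hbad
  by_contra hgood
  have hgood1 : ∀ U ∈ 𝓤, ∃ s ∈ (parallelRun B A σ x₀ S₀ (ξ · w) k).S, s ∈ U := by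
    intro U hU
    by_contra! hcon
    exact hgood (.inl (Set.mem_biUnion hU hcon))
  have hgood2 : (parallelRun B A σ x₀ S₀ (ξ · w) k).X i ∈ (volume.restrict Θ).support ∨
      (parallelRun B A σ x₀ S₀ (ξ · w) k).X i ∈ (parallelRun B A σ x₀ S₀ (ξ · w) k).S := by
    by_contra! hcon
    exact hgood (.inr hcon)
  have hs := hsur _ hgood1
  refine absurd hbad (not_lt.2 ?_)
  refine ((hw k).2 i).1.abs_accProb_sub_exactAcc_le hlam.le (by positivity) hmod
    (fun x hx y hy => h.cond.q_pos hx hy) (hw k).1.2 ((hw k).1.1 i)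
    (h.cond.support_subset ((hw k).2 i).2) (hgood2.imp_left (hs _)) (hs _ ((hw k).2 i).2)
    |>.trans ?_
  have : 2 * (quadDim d * (A.lam * (η / (c + 1)))) = c * η / (c + 1) := by rw [hc]; ring
  rw [this, div_le_iff₀ (by positivity)]
  nlinarith

-- An acceptance variable farther than `η` from the exact threshold lies on the same side of both
-- thresholds.
omit [MeasurableSpace Z] in
theorem chainStep_fst_eq_exactStep {g : ℝ} {x : E d} {S : Finset (E d)} {ζ : Noise Z} {η : ℝ}
    (h1 : accError B A g x S ζ ≤ η) (h2 : η < |ζ.2.2 - exactAcc B A x (A.r x ζ.1)|) :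
    (chainStep B A g x S ζ).1 = exactStep B A x ζ := by
  have : ζ.2.2 < accProb B A x (A.r x ζ.1) (finalSet B A g x (A.r x ζ.1) S ζ.2.1) ↔
      ζ.2.2 < exactAcc B A x (A.r x ζ.1) := by
    obtain ⟨h3, h4⟩ := abs_le.1 h1
    rcases lt_abs.1 h2 with h5 | h5 <;> constructor <;> intro h6 <;> linarith
  simp only [chainStep, exactStep, this]

/-- A step of the approximate chain and a step of the exact chain, driven by the same noise, agree
with probability tending to one. -/
theorem IsRun.tendsto_measure_ne (h : IsRun ν Θ B A x₀ S₀ P ξ) {i : Fin n}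
    (hσ : {k | i ∈ σ k}.Infinite) (g : ℕ → ℝ) :
    Tendsto (fun k => P.real {w | (chainStep B A (g k)
      ((parallelRun B A σ x₀ S₀ (ξ · w) k).X i) (parallelRun B A σ x₀ S₀ (ξ · w) k).S
        (ξ (k, i) w)).1 ≠ exactStep B A ((parallelRun B A σ x₀ S₀ (ξ · w) k).X i)
          (ξ (k, i) w)}) atTop (𝓝 0) := by
  have hM := h.cond.measurableData
  rw [Metric.tendsto_atTop]
  intro ε hε
  -- With tolerance `ε / 4`, the acceptance variable is in the critical interval with probability at
  -- most `2 * (ε / 4) = ε / 2`; the other half is left for a large acceptance error.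
  have h1 := h.tendsto_measure_accError hσ g (show 0 < ε / 4 by positivity)
  obtain ⟨K, hK⟩ := eventually_atTop.1 (h1.eventually_lt_const (show 0 < ε / 2 by positivity))
  refine ⟨K, fun k hk => ?_⟩
  rw [Real.dist_eq, sub_zero, abs_of_nonneg measureReal_nonneg]
  have hX := (hM.parallelRun σ x₀ S₀ k).1 i
  have h2 : P.real {w | |(ξ (k, i) w).2.2 - exactAcc B A
      ((parallelRun B A σ x₀ S₀ (ξ · w) k).X i)
      (A.r ((parallelRun B A σ x₀ S₀ (ξ · w) k).X i) (ξ (k, i) w).1)| ≤ ε / 4} ≤ ε / 2 := by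
    have hX1 : Measurable fun p : (ℕ × Fin n → Noise Z) × Noise Z =>
        (parallelRun B A σ x₀ S₀ p.1 k).X i := hX.comp measurable_fst
    have hC : MeasurableSet {p : (ℕ × Fin n → Noise Z) × Noise Z |
        |p.2.2.2 - exactAcc B A ((parallelRun B A σ x₀ S₀ p.1 k).X i)
          (A.r ((parallelRun B A σ x₀ S₀ p.1 k).X i) p.2.1)| ≤ ε / 4} :=
      measurableSet_le (measurable_norm.comp (measurable_snd.snd.snd.sub (hM.exactAcc hX1
        (hM.proposal.comp (hX1.prodMk measurable_snd.fst))))) measurable_const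
    have h3 : P {w | |(ξ (k, i) w).2.2 - exactAcc B A
        ((parallelRun B A σ x₀ S₀ (ξ · w) k).X i)
        (A.r ((parallelRun B A σ x₀ S₀ (ξ · w) k).X i) (ξ (k, i) w).1)| ≤ ε / 4} ≤
        ENNReal.ofReal (2 * (ε / 4)) := by
      rw [measure_run_noise h.meas h.indep h.law k i (C := fun s ζ =>
        |ζ.2.2 - exactAcc B A (s.X i) (A.r (s.X i) ζ.1)| ≤ ε / 4) hC]
      refine (lintegral_mono (g := fun _ => ENNReal.ofReal (2 * (ε / 4))) fun w => ?_).trans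
        (by simp)
      exact noiseLaw_abs_sub_le (f := fun z => exactAcc B A
        ((parallelRun B A σ x₀ S₀ (ξ · w) k).X i)
        (A.r ((parallelRun B A σ x₀ S₀ (ξ · w) k).X i) z))
        (hM.exactAcc measurable_const (hM.proposal.comp measurable_prodMk_left)) _
    have h4 := ENNReal.toReal_mono ENNReal.ofReal_ne_top h3
    rw [ENNReal.toReal_ofReal (by positivity)] at h4
    exact h4.trans_eq (by ring)
  refine lt_of_le_of_lt ((measureReal_mono fun w hw => ?_).trans (measureReal_union_le _ _))
    ((add_lt_add_of_lt_of_le (hK k hk) h2).trans_eq (add_halves ε))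
  by_contra hcon
  simp only [Set.mem_union, Set.mem_ofPred_eq, not_or, not_lt, not_le] at hcon
  exact hw (chainStep_fst_eq_exactStep hcon.1 hcon.2)

/-- The current state and sample set are dependent, but the exact step uses only the state and fresh
noise, so its law is a kernel applied to the law of the state alone. -/
theorem IsRun.measureReal_exactStep (h : IsRun ν Θ B A x₀ S₀ P ξ) (i : Fin n) (k : ℕ)
    {S : Set (E d)} (hS : MeasurableSet S) :
    P.real {w | exactStep B A ((parallelRun B A σ x₀ S₀ (ξ · w) k).X i) (ξ (k, i) w) ∈ S} =
      ∫ x, (noiseLaw ν).real {ζ | exactStep B A x ζ ∈ S}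
        ∂(P.map fun w => (parallelRun B A σ x₀ S₀ (ξ · w) k).X i) := by
  have hM := h.cond.measurableData
  have hX := (hM.parallelRun σ x₀ S₀ k).1 i
  have hX' : Measurable fun w => (parallelRun B A σ x₀ S₀ (ξ · w) k).X i :=
    hX.comp (measurable_pi_lambda _ h.meas)
  have hmeas : Measurable fun x => noiseLaw ν {ζ | exactStep B A x ζ ∈ S} :=
    measurable_measure_prodMk_left (s := {p : E d × Noise Z | exactStep B A p.1 p.2 ∈ S})
      (hM.exactStep hS)
  have hC : MeasurableSet {p : (ℕ × Fin n → Noise Z) × Noise Z |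
      exactStep B A ((parallelRun B A σ x₀ S₀ p.1 k).X i) p.2 ∈ S} :=
    (hM.exactStep.comp ((hX.comp measurable_fst).prodMk measurable_snd)) hS
  simp only [Measure.real]
  rw [measure_run_noise h.meas h.indep h.law k i (C := fun s ζ => exactStep B A (s.X i) ζ ∈ S) hC,
    integral_toReal hmeas.aemeasurable (by simp), lintegral_map hmeas hX']

/-- The laws of the states of each chain converge to the posterior along the common time. -/
theorem IsRun.tendsto_tvDist (h : IsRun ν Θ B A x₀ S₀ P ξ) {i : Fin n}
    (hσ : {k | i ∈ σ k}.Infinite) :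
    Tendsto (fun k => tvDist (P.map fun w => (parallelRun B A σ x₀ S₀ (ξ · w) k).X i)
      (B.posterior Θ)) atTop (𝓝 0) := by
  have hM := h.cond.measurableData
  have hΘ : Θ.Nonempty := ⟨_, h.init i⟩
  obtain ⟨κ, hκ0, hκ1, hcontr⟩ := h.cond.exists_contraction hΘ
  have hX : ∀ k, Measurable fun w => (parallelRun B A σ x₀ S₀ (ξ · w) k).X i := fun k =>
    ((hM.parallelRun σ x₀ S₀ k).1 i).comp (measurable_pi_lambda _ h.meas)
  -- The perturbation `e k` is the coupling failure probability, defined even at times when chain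
  -- `i` does not move.
  refine tendsto_zero_of_perturbed_contraction hσ (fun _ => tvDist_nonneg _ _) hκ0 hκ1
    (h.tendsto_measure_ne hσ fun k => A.γ (Nat.count (fun j => i ∈ σ j) k))
    (fun k hi => tvDist_le fun S hS => ?_) fun k hi => ?_
  · have hprob : IsProbabilityMeasure (P.map fun w => (parallelRun B A σ x₀ S₀ (ξ · w) k).X i) :=
      Measure.isProbabilityMeasure_map (hX k).aemeasurable
    have hmem : ∀ᵐ x ∂(P.map fun w => (parallelRun B A σ x₀ S₀ (ξ · w) k).X i), x ∈ Θ :=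
      (ae_map_iff (hX k).aemeasurable h.cond.measurableSet).2
        ((h.ae_regular σ).mono fun w hw => (hw k).1.1 i)
    have h1 := hcontr _ hprob hmem S hS
    rw [← h.measureReal_exactStep i k hS] at h1
    have h2 := abs_measureReal_sub_le P (fun w => (chainStep B A
      (A.γ (Nat.count (fun j => i ∈ σ j) k)) ((parallelRun B A σ x₀ S₀ (ξ · w) k).X i)
      (parallelRun B A σ x₀ S₀ (ξ · w) k).S (ξ (k, i) w)).1)
      (fun w => exactStep B A ((parallelRun B A σ x₀ S₀ (ξ · w) k).X i) (ξ (k, i) w)) S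
    rw [map_measureReal_apply (hX (k + 1)) hS]
    simp only [Set.preimage, parallelRun_succ_X_of_mem hi]
    refine (abs_sub_le _ _ _).trans ((add_le_add h2 h1).trans_eq (add_comm _ _))
  · simp only [parallelRun_succ_X_of_notMem hi, le_refl]

end Convergence

end LocalApproxMCMC

theorem mainTheorem1 {d m n : ℕ}
    {Z : Type*} [MeasurableSpace Z] (ν : Measure Z) [IsProbabilityMeasure ν]
    (Θ : Set (LocalApproxMCMC.E d))
    (B : LocalApproxMCMC.BayesProblem d m) (A : LocalApproxMCMC.AlgParams d Z)
    (hA : LocalApproxMCMC.SufficientConditions Θ B A ν)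
    (σ : ℕ → Finset (Fin n)) (hσ : ∀ i, {k | i ∈ σ k}.Infinite)
    (x₀ : Fin n → LocalApproxMCMC.E d) (hx₀ : ∀ i, x₀ i ∈ Θ)
    (S₀ : Finset (LocalApproxMCMC.E d)) (hS₀ : ∀ s ∈ S₀, s ∈ Θ)
    {Ω : Type*} [MeasurableSpace Ω] (P : Measure Ω) [IsProbabilityMeasure P]
    (ξ : ℕ × Fin n → Ω → LocalApproxMCMC.Noise Z)
    (hξ_meas : ∀ a, Measurable (ξ a)) (hξ_indep : iIndepFun ξ P)
    (hξ_law : ∀ a, P.map (ξ a) = LocalApproxMCMC.noiseLaw ν) (i : Fin n) :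
    Tendsto
      (fun t => LocalApproxMCMC.tvDist
        (P.map fun w => LocalApproxMCMC.chainState B A σ x₀ S₀ (fun a => ξ a w) i t)
        (B.posterior Θ))
      atTop (𝓝 0) := by
  have h : LocalApproxMCMC.IsRun ν Θ B A x₀ S₀ P ξ := ⟨hA, hx₀, hS₀, hξ_meas, hξ_indep, hξ_law⟩
  -- The state after `t` steps is read at the time when the next step is due, a strictly increasing
  -- sequence of common times.
  exact (h.tendsto_tvDist (hσ i)).comp (Nat.nth_strictMono (hσ i)).tendsto_atTop
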